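/- **Model.** Let $n,L\ge 1$, $M\ge 2$, $0\le K_a\le M$ be integers, $J=\log_2 M$, $[M]=\{1,\dots,M\}$. Each of $K_a$ active users $k$ (with $K_a$ fixed and known) picks a message $W_k$, independently and uniformly from $[M]$; with a common codebook $\mathbf x_1,\dots,\mathbf x_M\in\mathbb C^n$ the receiver with $L$ antennas observes $\mathbf y_l=\sum_{k} h_{k,l}\mathbf x_{W_k}+\mathbf z_l$, $l\in[L]$, where $h_{k,l}\sim\mathcal{CN}(0,1)$ and $\mathbf z_l\sim\mathcal{CN}(\mathbf 0,\mathbf I_n)$ are all independent and independent of the messages. For $\epsilon_J\ge 0$ and $P>0$, an $(n,M,\epsilon_J,P)$ code consists of a codebook with $\|\mathbf x_m\|_2^2\le nP$ for all $m$ and a measurable decoder that maps $\mathbf Y=[\mathbf y_1,\dots,\mathbf y_L]$ to a set $\hat{\mathcal W}\subset[M]$ of size $K_a$, such that $\mathbb P[\mathcal W\ne\hat{\mathcal W}]\le\epsilon_J$, where $\mathcal W=\{W_1,\dots,W_{K_a}\}$ is the set of distinct transmitted messages. Let $E^*_{b,J}(n,M,\epsilon_J)$ be the infimum of $nP/J$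 over all $P>0$ for which such a code exists (infima of empty sets are $+\infty$). **Theorem.** Choose one of two random codebooks $\mathbf C=[\mathbf c_1,\dots,\mathbf c_M]$ with i.i.d. columns: *Gaussian*, $\mathbf c_i\sim\mathcal{CN}(\mathbf 0,P'\mathbf I_n)$, or *spherical*, $\mathbf c_i$ uniform on the sphere of radius $\sqrt{nP'}$ in $\mathbb C^n$. Say that $P>0$ is admissible if $$\epsilon_J\ \ge\ \inf_{P'}\Big\{p_0+\sum_{t=1}^{K_a}p_t\Big\},$$ with $P'$ ranging over $0<P'<P$ in the Gaussian case and over $0<P'\le P$ in the spherical case. Then for every admissible $P$ there is an $(n,M,\epsilon_J,P)$ code, and $$E^*_{b,J}(n,M,\epsilon_J)\ \le\ \inf_{P\text{ admissible}}\frac{nP}{J}.$$ Here $p_0=\binom{K_a}{2}/M+p_{0,K_a}$, where $p_{0,K_a}=K_a\Gamma(n,nP/P')/\Gamma(n)$ in the Gaussian case and $p_{0,K_a}=0$ in the spherical case, and $$p_t=\inf_{0\le\omega\le1,\ \nu\ge0}\{q_{1,t}(\omega,\nu)+q_{2,t}(\omega,\nu)\},$$ $$q_{1,t}(\omega,\nu)=\binom{K_a}{t}\binom{M-K_a}{t}\,\mathbb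 E\Big[\inf_{u\ge0,\,r\ge0,\,\lambda_{\min}(\mathbf B)>0}e^{Lrn\nu}\,e^{L((u-r)\ln|\mathbf F|-u\ln|\mathbf F'|+r\omega\ln|\mathbf F_1|-\ln|\mathbf B|)}\Big],$$ $$q_{2,t}(\omega,\nu)=\binom{K_a}{t}\inf_{\delta\ge0}\Big\{\frac{\Gamma(nL,nL(1+\delta))}{\Gamma(nL)}+\mathbb E\Big[\frac{\gamma(Lm,c_\delta)}{\Gamma(Lm)}\Big]\Big\},$$ $$c_\delta=\frac{L\big(n(1+\delta)(1-\omega)-\omega\ln|\mathbf F_1|+\ln|\mathbf F|-n\nu\big)}{\omega\prod_{i=1}^m\lambda_i^{1/m}}.$$ The expectations are over $\mathbf C$ and $|\cdot|$ is the determinant. With $\mathcal W=[K_a]$, $\mathcal W_1=[t]$, $\mathcal W_2=\{K_a+1,\dots,K_a+t\}$ ($q_{1,t}=0$ if $t>M-K_a$), $\mathbf C_S$ the matrix with columns $\mathbf c_i$, $i\in S$, and $\mathbf G_S=\mathbf I_n+\mathbf C_S\mathbf C_S^H$, we put $\mathbf F=\mathbf G_{\mathcal W}$, $\mathbf F_1=\mathbf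 G_{\mathcal W\setminus\mathcal W_1}$, $\mathbf F'=\mathbf G_{(\mathcal W\setminus\mathcal W_1)\cup\mathcal W_2}$ and $\mathbf B=(1-u+r)\mathbf I_n+u\,\mathbf F'^{-1}\mathbf F-r\omega\,\mathbf F_1^{-1}\mathbf F$ (whose eigenvalues are real); $\lambda_1\ge\dots\ge\lambda_n$ are the eigenvalues of $\mathbf F_1^{-1}\mathbf C_{\mathcal W_1}\mathbf C_{\mathcal W_1}^H$ and $m=\min\{n,t\}$. Finally $\Gamma(x,y)=\int_y^\infty z^{x-1}e^{-z}dz$, and $\gamma(x,y)=\int_0^y z^{x-1}e^{-z}dz$ for $y>0$, $\gamma(x,y)=0$ for $y\le0$. If the denominator of $c_\delta$ is $0$, the ratio $\gamma(Lm,c_\delta)/\Gamma(Lm)$ is read as $1$ when the numerator is positive and as $0$ otherwise. -/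

import Mathlib

open MeasureTheory ProbabilityTheory
open scoped ENNReal NNReal Matrix

noncomputable section

namespace URA

/-! ### The channel and codes with a joint error probability constraint -/

/-- The circularly symmetric complex Gaussian law `CN(0, v)`: real and imaginary parts are
independent real Gaussians of variance `v / 2`. -/
def complexGaussian (v : ℝ≥0) : Measure ℂ :=
  ((gaussianReal 0 (v / 2)).prod (gaussianReal 0 (v / 2))).map
    Complex.measurableEquivRealProd.symm

/-- The received signal `Y = ∑ₖ x_{Wₖ} hₖᵀ + Z` (an `n × L` array): active user `k` sends the codeword
of its message `w k`, `h k l` is its fading coefficient at antenna `l`, `z` is the noise. -/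
def received {n M L Ka : ℕ} (x : Fin M → EuclideanSpace ℂ (Fin n)) (w : Fin Ka → Fin M)
    (h : Fin Ka → Fin L → ℂ) (z : Fin n → Fin L → ℂ) : Fin n → Fin L → ℂ :=
  fun i l => ∑ k, h k l * x (w k) i + z i l

/-- The joint law of the messages (i.i.d. uniform on the `M` messages), the fading coefficients
(i.i.d. `CN(0, 1)`) and the noise (i.i.d. `CN(0, 1)` entries), all independent. -/
def channelLaw (n M L Ka : ℕ) :
    Measure ((Fin Ka → Fin M) × (Fin Ka → Fin L → ℂ) × (Fin n → Fin L → ℂ)) :=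
  (Measure.pi fun _ => uniformOn (Set.univ : Set (Fin M))).prod
    ((Measure.pi fun _ => Measure.pi fun _ => complexGaussian 1).prod
      (Measure.pi fun _ => Measure.pi fun _ => complexGaussian 1))

/-- The probability that the decoded set differs from the set of distinct transmitted messages. -/
def jointErrorProb {n M L Ka : ℕ} (enc : Fin M → EuclideanSpace ℂ (Fin n))
    (dec : (Fin n → Fin L → ℂ) → Finset (Fin M)) : ℝ≥0∞ :=
  channelLaw n M L Ka
    {ω | (Finset.univ.image ω.1 : Finset (Fin M)) ≠ dec (received enc ω.1 ω.2.1 ω.2.2)}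

/-- An `(n, M, ε, P)` URA code (for `L` receive antennas and `Ka` active users) under the joint
error probability constraint. -/
structure Code (n M L Ka : ℕ) (ε : ℝ≥0) (P : ℝ) where
  /-- the common codebook -/
  enc : Fin M → EuclideanSpace ℂ (Fin n)
  /-- the decoder, which outputs a set of `Ka` messages -/
  dec : (Fin n → Fin L → ℂ) → Finset (Fin M)
  power_le : ∀ m, ‖enc m‖ ^ 2 ≤ n * P
  measurableSet_dec : ∀ S, MeasurableSet (dec ⁻¹' {S})
  card_dec : ∀ y, (dec y).card = Ka
  error_le : jointErrorProb (Ka := Ka) enc dec ≤ ε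

/-- The energy-per-bit `n P / J`, where `J = log₂ M`. -/
def energyPerBit (n M : ℕ) (P : ℝ) : ℝ := n * P / Real.logb 2 M

/-- The minimum energy-per-bit `E*_{b,J}(n, M, ε)`: the infimum of `n P / J` over all `P > 0` for
which an `(n, M, ε, P)` code exists (`∞` if there is none). -/
def minEnergyPerBit (n M L Ka : ℕ) (ε : ℝ≥0) : ℝ≥0∞ :=
  ⨅ P ∈ {P : ℝ | 0 < P ∧ Nonempty (Code n M L Ka ε P)}, ENNReal.ofReal (energyPerBit n M P)

/-! ### Random codebooks -/

/-- The two random coding schemes: i.i.d. Gaussian codewords, or i.i.d. codewords that are uniform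
on a sphere. -/
inductive Ensemble
  | gaussian
  | sphere

/-- The uniform distribution on the unit sphere of `ℂⁿ`. -/
def uniformSphere (n : ℕ) : Measure (Metric.sphere (0 : EuclideanSpace ℂ (Fin n)) 1) :=
  ((volume : Measure (EuclideanSpace ℂ (Fin n))).toSphere Set.univ)⁻¹ •
    (volume : Measure (EuclideanSpace ℂ (Fin n))).toSphere

/-- The law of one random codeword: `CN(0, P' Iₙ)`, or uniform on the sphere of radius
`√(n P')`. -/
def codewordLaw (n : ℕ) (P' : ℝ) : Ensemble → Measure (EuclideanSpace ℂ (Fin n))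
  | .gaussian => (Measure.pi fun _ : Fin n => complexGaussian P'.toNNReal).map (WithLp.toLp 2)
  | .sphere => (uniformSphere n).map
      fun x : Metric.sphere (0 : EuclideanSpace ℂ (Fin n)) 1 =>
        Real.sqrt (n * P') • (x : EuclideanSpace ℂ (Fin n))

/-- The law of the random codebook, with i.i.d. codewords. -/
def codebookLaw (n M : ℕ) (P' : ℝ) (e : Ensemble) :
    Measure (Fin M → EuclideanSpace ℂ (Fin n)) :=
  Measure.pi fun _ => codewordLaw n P' e

/-- The admissible values of `P'`: `0 < P' < P` for Gaussian codewords, where `P' = P` is allowed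
for codewords on a sphere. -/
def powerRange (P : ℝ) : Ensemble → Set ℝ
  | .gaussian => Set.Ioo 0 P
  | .sphere => Set.Ioc 0 P

/-! ### Incomplete gamma functions -/

/-- The upper incomplete gamma function `Γ(a, y)`. -/
def upperGamma (a y : ℝ) : ℝ := ∫ s in Set.Ioi y, s ^ (a - 1) * Real.exp (-s)

/-- The lower incomplete gamma function `γ(a, y)`, equal to `0` for `y ≤ 0`. -/
def lowerGamma (a y : ℝ) : ℝ := ∫ s in Set.Ioc 0 y, s ^ (a - 1) * Real.exp (-s)

/-- `γ(a, N / D) / Γ(a)` for `D ≥ 0`. For `D = 0` the quotient `N / D` is read as `+∞` if `N > 0`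
(so that the value is `1`), and the value is `0` if `N ≤ 0`. -/
def lowerGammaRatio (a N D : ℝ) : ℝ :=
  if D = 0 then (if 0 < N then 1 else 0) else lowerGamma a (N / D) / Real.Gamma a

/-! ### The error bound -/

section Bound

variable {n M : ℕ}

/-- The matrix `C_S` whose columns are the codewords indexed by `S`. -/
def subcode (C : Fin M → EuclideanSpace ℂ (Fin n)) (S : Finset (Fin M)) : Matrix (Fin n) S ℂ :=
  Matrix.of fun i j => C j i

/-- `Iₙ + C_S C_Sᴴ`. -/
def covMat (C : Fin M → EuclideanSpace ℂ (Fin n)) (S : Finset (Fin M)) :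
    Matrix (Fin n) (Fin n) ℂ :=
  1 + subcode C S * (subcode C S)ᴴ

/-- The transmitted messages `𝒲`: the first `Ka` messages. -/
def sent (M Ka : ℕ) : Finset (Fin M) := {i | (i : ℕ) < Ka}

/-- The misdecoded messages `𝒲₁`: the first `t` messages. -/
def missed (M t : ℕ) : Finset (Fin M) := {i | (i : ℕ) < t}

/-- The falsely decoded messages `𝒲₂`: the `t` messages after the first `Ka` ones. -/
def falseAlarm (M Ka t : ℕ) : Finset (Fin M) := {i | Ka ≤ (i : ℕ) ∧ (i : ℕ) < Ka + t}

/-- `F`, built from `𝒲`. -/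
def matF (Ka : ℕ) (C : Fin M → EuclideanSpace ℂ (Fin n)) : Matrix (Fin n) (Fin n) ℂ :=
  covMat C (sent M Ka)

/-- `F₁`, built from `𝒲 \ 𝒲₁`. -/
def matF₁ (Ka t : ℕ) (C : Fin M → EuclideanSpace ℂ (Fin n)) : Matrix (Fin n) (Fin n) ℂ :=
  covMat C (sent M Ka \ missed M t)

/-- `F'`, built from `(𝒲 \ 𝒲₁) ∪ 𝒲₂`. -/
def matF' (Ka t : ℕ) (C : Fin M → EuclideanSpace ℂ (Fin n)) : Matrix (Fin n) (Fin n) ℂ :=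
  covMat C ((sent M Ka \ missed M t) ∪ falseAlarm M Ka t)

/-- `B = (1 - u + r) Iₙ + u F'⁻¹ F - r ω F₁⁻¹ F`. -/
def matB (Ka t : ℕ) (ω u r : ℝ) (C : Fin M → EuclideanSpace ℂ (Fin n)) :
    Matrix (Fin n) (Fin n) ℂ :=
  ((1 - u + r : ℝ) : ℂ) • (1 : Matrix (Fin n) (Fin n) ℂ)
    + (u : ℂ) • ((matF' Ka t C)⁻¹ * matF Ka C)
    - ((r * ω : ℝ) : ℂ) • ((matF₁ Ka t C)⁻¹ * matF Ka C)

/-- `ln |A|` for a matrix with a positive determinant. -/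
def logDet (A : Matrix (Fin n) (Fin n) ℂ) : ℝ := Real.log A.det.re

/-- `λ_min(A) > 0`, for a matrix with real eigenvalues. -/
def EigenvaluesPos (A : Matrix (Fin n) (Fin n) ℂ) : Prop := ∀ μ ∈ spectrum ℂ A, 0 < μ.re

/-- The eigenvalues `λ₁ ≥ ⋯ ≥ λₙ` of a matrix with real eigenvalues, with multiplicity, in
decreasing order. -/
def sortedEigenvalues (A : Matrix (Fin n) (Fin n) ℂ) : List ℝ :=
  (A.charpoly.roots.map Complex.re).sort (· ≥ ·)

/-- `∏_{i ≤ m} λᵢ^{1/m}`, for the eigenvalues `λ₁ ≥ ⋯ ≥ λₙ` of `F₁⁻¹ C_{𝒲₁} C_{𝒲₁}ᴴ`. -/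
def eigGeomMean (Ka t m : ℕ) (C : Fin M → EuclideanSpace ℂ (Fin n)) : ℝ :=
  (((sortedEigenvalues ((matF₁ Ka t C)⁻¹ *
      (subcode C (missed M t) * (subcode C (missed M t))ᴴ))).take m).map
    fun x => x ^ (1 / (m : ℝ))).prod

/-- `q_{1,t}(ω, ν)`; the minimum over `u`, `r` is an infimum. -/
def q₁ (n M L Ka : ℕ) (e : Ensemble) (P' : ℝ) (t : ℕ) (ω ν : ℝ) : ℝ≥0∞ :=
  (Ka.choose t : ℝ≥0∞) * ((M - Ka).choose t : ℝ≥0∞) *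
    ∫⁻ C, (⨅ u : ℝ, ⨅ r : ℝ, ⨅ _ : 0 ≤ u ∧ 0 ≤ r ∧ EigenvaluesPos (matB Ka t ω u r C),
      ENNReal.ofReal (Real.exp (L * r * n * ν) *
        Real.exp (L * ((u - r) * logDet (matF Ka C) - u * logDet (matF' Ka t C)
          + r * ω * logDet (matF₁ Ka t C) - logDet (matB Ka t ω u r C)))))
      ∂(codebookLaw n M P' e)

/-- The numerator of `c_δ`. -/
def cNum (L Ka t : ℕ) (ω ν δ : ℝ) (C : Fin M → EuclideanSpace ℂ (Fin n)) : ℝ :=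
  L * (n * (1 + δ) * (1 - ω) - ω * logDet (matF₁ Ka t C) + logDet (matF Ka C) - n * ν)

/-- `q_{2,t}(ω, ν)`, where `m = min {n, t}`; the minimum over `δ` is an infimum. -/
def q₂ (n M L Ka : ℕ) (e : Ensemble) (P' : ℝ) (t : ℕ) (ω ν : ℝ) : ℝ≥0∞ :=
  (Ka.choose t : ℝ≥0∞) * ⨅ δ : ℝ, ⨅ _ : 0 ≤ δ,
    (ENNReal.ofReal (upperGamma (n * L) (n * L * (1 + δ)) / Real.Gamma (n * L))
      + ∫⁻ C, ENNReal.ofReal (lowerGammaRatio (L * (min n t : ℕ)) (cNum L Ka t ω ν δ C)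
          (ω * eigGeomMean Ka t (min n t) C)) ∂(codebookLaw n M P' e))

/-- `p_t`, the bound on the probability of exactly `t` misdecoded messages. -/
def p (n M L Ka : ℕ) (e : Ensemble) (P' : ℝ) (t : ℕ) : ℝ≥0∞ :=
  ⨅ ω : ℝ, ⨅ ν : ℝ, ⨅ _ : 0 ≤ ω ∧ ω ≤ 1 ∧ 0 ≤ ν,
    (q₁ n M L Ka e P' t ω ν + q₂ n M L Ka e P' t ω ν)

/-- `p_{0,Ka}`, the bound on the probability that a transmitted codeword violates the power
constraint. -/
def powerViolation (n Ka : ℕ) (P P' : ℝ) : Ensemble → ℝ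
  | .gaussian => Ka * upperGamma n (n * P / P') / Real.Gamma n
  | .sphere => 0

/-- `p₀ = (Ka choose 2) / M + p_{0,Ka}`. -/
def p₀ (n M Ka : ℕ) (e : Ensemble) (P P' : ℝ) : ℝ≥0∞ :=
  ENNReal.ofReal ((Ka.choose 2 : ℝ) / M + powerViolation n Ka P P' e)

/-- The bound on the joint error probability: the minimum (as an infimum) over `P'` of
`p₀ + ∑_{t=1}^{Ka} p_t`. -/
def errorBound (n M L Ka : ℕ) (e : Ensemble) (P : ℝ) : ℝ≥0∞ :=
  ⨅ P' ∈ powerRange P e, (p₀ n M Ka e P P' + ∑ t ∈ Finset.Icc 1 Ka, p n M L Ka e P' t)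

end Bound

end URA

end

namespace URA

set_option linter.unusedSectionVars false

/-! ### Arrays of i.i.d. complex Gaussian entries: density and linear change of variables -/

section GaussianArrays

open Measure

/-! The proof is random coding with maximum likelihood decoding of a covariance matrix. Given the
messages, the columns of the received array are i.i.d. `CN(0, F)` with `F = 1 + X Xᴴ`, where `X`
holds the sent codewords (`map_received`). The decoder therefore picks the set of `Ka` codewords
that minimizes `metric`, that is `L ln|F| + tr(Yᴴ F⁻¹ Y)`. If it misses exactly `t` messages of `S`,
some `S \ W₁ ∪ W₂` with `|W₁| = |W₂| = t` has at most the metric of `S`.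

This event is split by Fano's good region, where `metric F ≤ ω * metric F₁ + n L ν` and `F₁` belongs
to `S \ W₁`. Inside the region, a Chernoff bound with one multiplier for each inequality (`u` and
`r`) leaves a Gaussian integral, whose value is the integrand of `q₁` (`gaussLaw_metric_le`).
Outside it, a congruence whitens `F` and diagonalizes `F₁⁻¹` at the same time. Once the event that
the whitened array has squared norm above `n L (1 + δ)` is set aside, a weighted sum of squared
Gaussian norms has to be small; Okamoto's inequality (`stdArray_weighted_le`) bounds that
probability by a lower incomplete gamma ratio (`gaussLaw_metric_gt_le`). The region does not involve
`W₂`, so the union bound there runs over `W₁` alone. Since the codewords are exchangeable, all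
choices of `S`, `W₁`, `W₂` reduce to the fixed index sets of the bound.

Repeated messages cost a birthday bound. Codewords of too large a power are replaced by `0`, which
costs the probability that a sent one is affected. Some codebook is at least as good as the average
(`exists_codebook`).

The infimum over `P'` need not be attained, so this only gives error probabilities arbitrarily close
to `ε`. Compactness closes the gap: `bayesError`, the least error probability over all decoders, is
lower semicontinuous in the codebook and so has a minimum on the compact set of codebooks that obey
the power constraint (`nonempty_code`). -/

lemma pi_withDensity_ofReal {ι X : Type*} [Fintype ι] [MeasurableSpace X] (μ : Measure X)
    [SigmaFinite μ] {f : X → ℝ} (hf0 : ∀ x, 0 ≤ f x) (hfi : Integrable f μ) :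
    Measure.pi (fun _ : ι => μ.withDensity fun x => ENNReal.ofReal (f x)) =
      (Measure.pi fun _ : ι => μ).withDensity fun x => ENNReal.ofReal (∏ i, f (x i)) := by
  have : IsFiniteMeasure (μ.withDensity fun x => ENNReal.ofReal (f x)) :=
    isFiniteMeasure_withDensity_ofReal hfi.2
  refine Measure.pi_eq fun s hs => ?_
  rw [withDensity_apply _ (MeasurableSet.univ_pi hs), ← lintegral_indicator (MeasurableSet.univ_pi hs)]
  have h1 : ∀ x : ι → X, (Set.univ.pi s).indicator (fun x => ENNReal.ofReal (∏ i, f (x i))) x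
      = ENNReal.ofReal (∏ i, (s i).indicator f (x i)) := by
    intro x
    by_cases hx : x ∈ Set.univ.pi s
    · rw [Set.indicator_of_mem hx]
      congr 1
      exact Finset.prod_congr rfl fun i _ => (Set.indicator_of_mem (hx i trivial) f).symm
    · rw [Set.indicator_of_notMem hx]
      simp only [Set.mem_pi, Set.mem_univ, true_imp_iff, not_forall] at hx
      obtain ⟨i, hi⟩ := hx
      rw [Finset.prod_eq_zero (Finset.mem_univ i) (Set.indicator_of_notMem hi f),
        ENNReal.ofReal_zero]
  have hint : ∀ i, Integrable ((s i).indicator f) μ := fun i => hfi.indicator (hs i)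
  have hnn : ∀ i x, 0 ≤ (s i).indicator f x := fun i x => Set.indicator_nonneg (fun x _ => hf0 x) x
  simp_rw [h1]
  rw [← ofReal_integral_eq_lintegral_ofReal (Integrable.fintype_prod_dep hint)
      (ae_of_all _ fun x => Finset.prod_nonneg fun i _ => hnn i _),
    integral_fintype_prod_eq_prod (f := fun i => (s i).indicator f),
    ENNReal.ofReal_prod_of_nonneg fun i _ => integral_nonneg (hnn i)]
  refine Finset.prod_congr rfl fun i _ => ?_
  rw [ofReal_integral_eq_lintegral_ofReal (hint i) (ae_of_all _ (hnn i)),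
    withDensity_apply _ (hs i), ← lintegral_indicator (hs i)]
  refine lintegral_congr fun x => ?_
  by_cases hx : x ∈ s i <;> simp [hx]

/-- The density of the law `CN(0, 1)`. -/
noncomputable def cgDensity (z : ℂ) : ℝ := Real.pi⁻¹ * Real.exp (-‖z‖ ^ 2)

lemma cgDensity_nonneg (z : ℂ) : 0 ≤ cgDensity z := by unfold cgDensity; positivity

lemma continuous_cgDensity : Continuous cgDensity := by unfold cgDensity; fun_prop

lemma complexGaussian_one :
    complexGaussian 1 = volume.withDensity fun z => ENNReal.ofReal (cgDensity z) := by
  have hv : ((1 : ℝ≥0) / 2) ≠ 0 := by positivity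
  have hmp := Complex.volume_preserving_equiv_real_prod.symm
  rw [complexGaussian, gaussianReal_of_var_ne_zero _ hv,
    prod_withDensity (measurable_gaussianPDF _ _) (measurable_gaussianPDF _ _)]
  refine Measure.ext fun s hs => ?_
  rw [map_apply (MeasurableEquiv.measurable _) hs,
    withDensity_apply _ (MeasurableEquiv.measurable _ hs), withDensity_apply _ hs,
    ← hmp.setLIntegral_comp_preimage_emb (MeasurableEquiv.measurableEmbedding _)]
  refine setLIntegral_congr_fun (MeasurableEquiv.measurable _ hs) fun p _ => ?_
  simp only [gaussianPDF]
  rw [← ENNReal.ofReal_mul (gaussianPDFReal_nonneg _ _ _)]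
  congr 1
  simp only [gaussianPDFReal, cgDensity, sub_zero]
  have h2 : ((1 / 2 : ℝ≥0) : ℝ) = 1 / 2 := by simp
  rw [h2, ← Complex.normSq_eq_norm_sq, mul_mul_mul_comm, ← Real.exp_add, ← mul_inv,
    Real.mul_self_sqrt (by positivity)]
  simp only [Complex.measurableEquivRealProd_symm_apply, Complex.normSq_mk]
  congr 2 <;> ring

instance (v : ℝ≥0) : IsProbabilityMeasure (complexGaussian v) :=
  isProbabilityMeasure_map (MeasurableEquiv.measurable _).aemeasurable

lemma integrable_cgDensity : Integrable cgDensity := by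
  refine ⟨continuous_cgDensity.aestronglyMeasurable, ?_⟩
  rw [hasFiniteIntegral_iff_ofReal (ae_of_all _ cgDensity_nonneg), ← setLIntegral_univ,
    ← withDensity_apply _ MeasurableSet.univ, ← complexGaussian_one]
  exact measure_lt_top _ _

variable {ι κ : Type*} [Fintype ι] [Fintype κ]

/-- The law of an array of i.i.d. `CN(0, 1)` entries. -/
noncomputable def stdArray (ι κ : Type*) [Fintype ι] [Fintype κ] : Measure (ι → κ → ℂ) :=
  Measure.pi fun _ => Measure.pi fun _ => complexGaussian 1

instance : IsProbabilityMeasure (stdArray ι κ) := by unfold stdArray; infer_instance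

/-- The squared Frobenius norm of an array. -/
noncomputable def sqNorm (y : ι → κ → ℂ) : ℝ := ∑ i, ∑ l, ‖y i l‖ ^ 2

lemma continuous_sqNorm : Continuous (sqNorm : (ι → κ → ℂ) → ℝ) := by unfold sqNorm; fun_prop

/-- The density of `stdArray`. -/
noncomputable def stdDensity (y : ι → κ → ℂ) : ℝ :=
  (Real.pi ^ (Fintype.card ι * Fintype.card κ))⁻¹ * Real.exp (-sqNorm y)

lemma continuous_stdDensity : Continuous (stdDensity : (ι → κ → ℂ) → ℝ) := by
  unfold stdDensity
  exact continuous_const.mul (Real.continuous_exp.comp continuous_sqNorm.neg)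

lemma stdDensity_nonneg (y : ι → κ → ℂ) : 0 ≤ stdDensity y := by unfold stdDensity; positivity

lemma stdArray_eq_withDensity :
    stdArray ι κ = volume.withDensity fun y => ENNReal.ofReal (stdDensity y) := by
  have h1 := pi_withDensity_ofReal (ι := κ) volume
    cgDensity_nonneg integrable_cgDensity
  have h2 := pi_withDensity_ofReal (ι := ι) (volume : Measure (κ → ℂ))
    (f := fun x => ∏ l, cgDensity (x l))
    (fun x => Finset.prod_nonneg fun l _ => cgDensity_nonneg _)
    (Integrable.fintype_prod (f := fun _ => cgDensity) fun _ => integrable_cgDensity)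
  rw [stdArray, complexGaussian_one, h1]
  refine h2.trans ?_
  congr 1
  ext y
  congr 1
  simp only [cgDensity, Finset.prod_mul_distrib, Finset.prod_const, Finset.card_univ,
    ← Real.exp_sum, stdDensity, sqNorm, Finset.sum_neg_distrib]
  rw [inv_pow, inv_pow, ← pow_mul, mul_comm (Fintype.card κ)]

lemma lintegral_stdArray {f : (ι → κ → ℂ) → ℝ≥0∞} (hf : Measurable f) :
    ∫⁻ y, f y ∂stdArray ι κ = ∫⁻ y, ENNReal.ofReal (stdDensity y) * f y := by
  rw [stdArray_eq_withDensity, lintegral_withDensity_eq_lintegral_mul _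
    continuous_stdDensity.measurable.ennreal_ofReal hf]
  rfl

lemma lintegral_stdDensity : ∫⁻ y : ι → κ → ℂ, ENNReal.ofReal (stdDensity y) = 1 := by
  have := lintegral_stdArray (ι := ι) (κ := κ) (f := fun _ => 1) measurable_const
  simpa using this.symm

/-- Left multiplication of an array by a matrix. -/
def lmul {ι' : Type*} [Fintype ι'] (R : Matrix ι ι' ℂ) : (ι' → κ → ℂ) →ₗ[ℂ] (ι → κ → ℂ) where
  toFun y := (R * Matrix.of y : Matrix ι κ ℂ)
  map_add' x y := Matrix.mul_add R (Matrix.of x) (Matrix.of y)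
  map_smul' c y := Matrix.mul_smul R c (Matrix.of y)

lemma lmul_apply {ι' : Type*} [Fintype ι'] (R : Matrix ι ι' ℂ) (y : ι' → κ → ℂ) (i : ι) (l : κ) :
    lmul R y i l = ∑ j, R i j * y j l := rfl

lemma of_lmul {ι' : Type*} [Fintype ι'] (R : Matrix ι ι' ℂ) (y : ι' → κ → ℂ) :
    Matrix.of (lmul R y) = R * Matrix.of y := rfl

lemma continuous_lmul {ι' : Type*} [Fintype ι'] (R : Matrix ι ι' ℂ) :
    Continuous (lmul R : (ι' → κ → ℂ) → ι → κ → ℂ) := by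
  refine continuous_pi fun i => continuous_pi fun l => ?_
  simp only [lmul_apply]
  fun_prop

-- After uncurrying, `lmul R` is the Kronecker product of `R` with the identity on `κ`: it acts by
-- `R` on each column separately.
open scoped Kronecker in
lemma det_lmul [DecidableEq ι] (R : Matrix ι ι ℂ) :
    LinearMap.det (lmul (κ := κ) R) = R.det ^ Fintype.card κ := by
  classical
  have h : lmul (κ := κ) R = ((LinearEquiv.curry ℂ ℂ ι κ : (ι × κ → ℂ) ≃ₗ[ℂ] (ι → κ → ℂ)) :
      (ι × κ → ℂ) →ₗ[ℂ] (ι → κ → ℂ)) ∘ₗ Matrix.toLin' (R ⊗ₖ (1 : Matrix κ κ ℂ)) ∘ₗ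
      ((LinearEquiv.curry ℂ ℂ ι κ).symm : (ι → κ → ℂ) →ₗ[ℂ] (ι × κ → ℂ)) := by
    refine LinearMap.ext fun y => funext fun i => funext fun l => ?_
    simp [lmul_apply, Matrix.mulVec, dotProduct, Fintype.sum_prod_type, Matrix.one_apply]
  rw [h, LinearMap.det_conj, LinearMap.det_toLin', Matrix.det_kronecker]
  simp

instance : (volume : Measure (ι → κ → ℂ)).IsAddHaarMeasure :=
  Measure.pi.isAddHaarMeasure _

lemma map_lmul_volume [DecidableEq ι] {R : Matrix ι ι ℂ} (hR : R.det ≠ 0) :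
    Measure.map (lmul R) (volume : Measure (ι → κ → ℂ)) =
      ENNReal.ofReal ((‖R.det‖ ^ 2) ^ Fintype.card κ)⁻¹ • volume := by
  -- Lebesgue measure scales by the real determinant, which is the squared modulus of the complex
  -- one.
  have hdet : LinearMap.det ((lmul (κ := κ) R).restrictScalars ℝ) =
      (‖R.det‖ ^ 2) ^ Fintype.card κ := by
    rw [LinearMap.det_restrictScalars, Algebra.norm_complex_apply, det_lmul, map_pow,
      Complex.normSq_eq_norm_sq]
  have h0 : LinearMap.det ((lmul (κ := κ) R).restrictScalars ℝ) ≠ 0 := by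
    rw [hdet]; positivity
  have := map_linearMap_addHaar_eq_smul_addHaar (volume : Measure (ι → κ → ℂ)) h0
  rw [hdet, abs_of_nonneg (by positivity)] at this
  exact this

lemma lintegral_comp_lmul [DecidableEq ι] {R : Matrix ι ι ℂ} (hR : R.det ≠ 0)
    {f : (ι → κ → ℂ) → ℝ≥0∞} (hf : Measurable f) :
    ∫⁻ y, f (lmul R y) = ENNReal.ofReal ((‖R.det‖ ^ 2) ^ Fintype.card κ)⁻¹ * ∫⁻ y, f y := by
  rw [← lintegral_map hf (continuous_lmul R).measurable, map_lmul_volume hR,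
    lintegral_smul_measure, smul_eq_mul]

end GaussianArrays

/-! ### Factorization and simultaneous diagonalization of Hermitian matrices -/

section Factorization

open scoped ComplexOrder

variable {ι : Type*} [Fintype ι] [DecidableEq ι]

lemma exists_unitary_diagonalization {A : Matrix ι ι ℂ} (hA : A.PosSemidef) :
    ∃ (U : Matrix ι ι ℂ) (d : ι → ℝ), (∀ i, 0 ≤ d i) ∧ U * Uᴴ = 1 ∧ Uᴴ * U = 1 ∧
      A = U * Matrix.diagonal (fun i => (d i : ℂ)) * Uᴴ := by
  refine ⟨hA.1.eigenvectorUnitary, hA.1.eigenvalues, hA.eigenvalues_nonneg,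
    Unitary.coe_mul_star_self _, Unitary.coe_star_mul_self _, ?_⟩
  conv_lhs => rw [hA.1.spectral_theorem, Unitary.conjStarAlgAut_apply]
  rfl

lemma diagonal_sqrt_mul_self {d : ι → ℝ} (hd : ∀ i, 0 ≤ d i) :
    Matrix.diagonal (fun i => ((Real.sqrt (d i) : ℝ) : ℂ)) *
      Matrix.diagonal (fun i => ((Real.sqrt (d i) : ℝ) : ℂ)) =
      Matrix.diagonal fun i => (d i : ℂ) := by
  rw [Matrix.diagonal_mul_diagonal]
  congr 1
  ext i
  rw [← Complex.ofReal_mul, Real.mul_self_sqrt (hd i)]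

lemma diagonal_ofReal_conjTranspose (d : ι → ℝ) :
    (Matrix.diagonal fun i => (d i : ℂ))ᴴ = Matrix.diagonal fun i => (d i : ℂ) := by
  rw [Matrix.diagonal_conjTranspose]
  congr 1
  ext i
  simp

lemma exists_mul_conjTranspose_of_posDef {F : Matrix ι ι ℂ} (hF : F.PosDef) :
    ∃ R : Matrix ι ι ℂ, R.det ≠ 0 ∧ F = R * Rᴴ := by
  obtain ⟨U, d, hd, -, -, h⟩ := exists_unitary_diagonalization hF.posSemidef
  have hR : F = (U * Matrix.diagonal (fun i => ((Real.sqrt (d i) : ℝ) : ℂ))) *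
      (U * Matrix.diagonal (fun i => ((Real.sqrt (d i) : ℝ) : ℂ)))ᴴ := by
    rw [Matrix.conjTranspose_mul, diagonal_ofReal_conjTranspose, h,
      ← diagonal_sqrt_mul_self hd]
    simp only [Matrix.mul_assoc]
  refine ⟨_, fun h0 => ?_, hR⟩
  have := hF.det_pos.ne'
  rw [hR, Matrix.det_mul, h0, zero_mul] at this
  exact this rfl

/-- A positive definite matrix and a larger one are diagonalized simultaneously by a congruence. -/
lemma exists_simultaneous_diagonalization {F₁ K : Matrix ι ι ℂ} (hF : F₁.PosDef)
    (hK : K.PosSemidef) :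
    ∃ (R : Matrix ι ι ℂ) (d : ι → ℝ), (∀ i, 0 ≤ d i) ∧ R.det ≠ 0 ∧ F₁ + K = R * Rᴴ ∧
      Rᴴ * F₁⁻¹ * R = Matrix.diagonal (fun i => ((1 + d i : ℝ) : ℂ)) ∧
      (F₁⁻¹ * K).charpoly = (Matrix.diagonal fun i => (d i : ℂ)).charpoly := by
  -- With `F₁ = T Tᴴ` and `T⁻¹ K T⁻ᴴ = U diag(d) Uᴴ`, the matrix sought is `R = T U diag(√(1 + d))`.
  -- The `d i` are the eigenvalues of `F₁⁻¹ K` because `X Y` and `Y X` have the same characteristic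
  -- polynomial.
  obtain ⟨T, hT, rfl⟩ := exists_mul_conjTranspose_of_posDef hF
  have hTu : IsUnit T.det := isUnit_iff_ne_zero.2 hT
  have hTu' : IsUnit Tᴴ.det := by rw [Matrix.det_conjTranspose]; exact hTu.star
  obtain ⟨U, d, hd, hU, hU', hUd⟩ :=
    exists_unitary_diagonalization (hK.mul_mul_conjTranspose_same T⁻¹)
  have hd1 : ∀ i, 0 ≤ 1 + d i := fun i => by linarith [hd i]
  set S := Matrix.diagonal (fun i => ((Real.sqrt (1 + d i) : ℝ) : ℂ)) with hS
  have hSS : S * S = 1 + Matrix.diagonal (fun i => (d i : ℂ)) := by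
    rw [hS, diagonal_sqrt_mul_self hd1, ← Matrix.diagonal_one, Matrix.diagonal_add]
    congr 1
    ext i
    push_cast
    rfl
  have hSH : Sᴴ = S := diagonal_ofReal_conjTranspose _
  have hK' : K = T * (T⁻¹ * K * T⁻¹ᴴ) * Tᴴ := by
    rw [Matrix.conjTranspose_nonsing_inv]
    simp only [Matrix.mul_assoc, Matrix.nonsing_inv_mul _ hTu', Matrix.mul_one]
    rw [← Matrix.mul_assoc, Matrix.mul_nonsing_inv _ hTu, Matrix.one_mul]
  have hsum : T * Tᴴ + K = (T * U * S) * (T * U * S)ᴴ := by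
    calc T * Tᴴ + K = T * (U * (S * S) * Uᴴ) * Tᴴ := by
          rw [hSS, Matrix.mul_add, Matrix.mul_one, Matrix.add_mul, hU, ← hUd, Matrix.mul_add,
            Matrix.add_mul, Matrix.mul_one, ← hK']
      _ = (T * U * S) * (T * U * S)ᴴ := by
          rw [Matrix.conjTranspose_mul, Matrix.conjTranspose_mul, hSH]
          simp only [Matrix.mul_assoc]
  have hdet : (T * U * S).det ≠ 0 := by
    intro h0
    have := (hF.add_posSemidef hK).det_pos.ne'
    rw [hsum, Matrix.det_mul, h0, zero_mul] at this
    exact this rfl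
  refine ⟨T * U * S, d, hd, hdet, hsum, ?_, ?_⟩
  · calc (T * U * S)ᴴ * (T * Tᴴ)⁻¹ * (T * U * S)
        = S * (Uᴴ * ((Tᴴ * Tᴴ⁻¹) * ((T⁻¹ * T) * (U * S)))) := by
          rw [Matrix.conjTranspose_mul, Matrix.conjTranspose_mul, hSH, Matrix.mul_inv_rev]
          simp only [Matrix.mul_assoc]
      _ = S * S := by
          rw [Matrix.mul_nonsing_inv _ hTu', Matrix.nonsing_inv_mul _ hTu, Matrix.one_mul,
            Matrix.one_mul, ← Matrix.mul_assoc Uᴴ, hU', Matrix.one_mul]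
      _ = _ := diagonal_sqrt_mul_self hd1
  · rw [Matrix.mul_inv_rev, Matrix.mul_assoc, Matrix.charpoly_mul_comm,
      ← Matrix.conjTranspose_nonsing_inv, hUd, Matrix.mul_assoc, Matrix.charpoly_mul_comm,
      Matrix.mul_assoc, hU', Matrix.mul_one]

end Factorization

/-! ### The quadratic form `tr (yᴴ A y)` -/

section QuadraticForm

variable {ι κ : Type*} [Fintype ι] [Fintype κ]

/-- The real quadratic form `tr (yᴴ A y)`. -/
noncomputable def quad (A : Matrix ι ι ℂ) (y : ι → κ → ℂ) : ℝ :=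
  ((Matrix.of y)ᴴ * A * Matrix.of y).trace.re

lemma quad_lmul {ι' : Type*} [Fintype ι'] (A : Matrix ι ι ℂ) (R : Matrix ι ι' ℂ)
    (y : ι' → κ → ℂ) : quad A (lmul R y) = quad (Rᴴ * A * R) y := by
  simp only [quad, of_lmul, Matrix.conjTranspose_mul, Matrix.mul_assoc]

lemma quad_add (A B : Matrix ι ι ℂ) (y : ι → κ → ℂ) : quad (A + B) y = quad A y + quad B y := by
  simp [quad, Matrix.mul_add, Matrix.add_mul]

lemma quad_sub (A B : Matrix ι ι ℂ) (y : ι → κ → ℂ) : quad (A - B) y = quad A y - quad B y := by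
  simp [quad, Matrix.mul_sub, Matrix.sub_mul]

lemma quad_smul (c : ℝ) (A : Matrix ι ι ℂ) (y : ι → κ → ℂ) :
    quad ((c : ℂ) • A) y = c * quad A y := by
  simp [quad, Matrix.trace_smul]

lemma quad_diagonal [DecidableEq ι] (d : ι → ℝ) (y : ι → κ → ℂ) :
    quad (Matrix.diagonal fun i => (d i : ℂ)) y = ∑ i, d i * ∑ l, ‖y i l‖ ^ 2 := by
  simp only [quad, Matrix.trace, Matrix.diag_apply, Matrix.mul_apply (N := Matrix.of y),
    Matrix.mul_diagonal, Matrix.conjTranspose_apply, Matrix.of_apply, Complex.re_sum,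
    Finset.mul_sum]
  rw [Finset.sum_comm]
  refine Finset.sum_congr rfl fun i _ => Finset.sum_congr rfl fun l _ => ?_
  have : star (y i l) * (d i : ℂ) * y i l = ((d i * ‖y i l‖ ^ 2 : ℝ) : ℂ) := by
    rw [mul_right_comm, Complex.star_def, Complex.conj_mul']
    push_cast
    ring
  rw [this, Complex.ofReal_re]

lemma quad_one [DecidableEq ι] (y : ι → κ → ℂ) : quad 1 y = sqNorm y := by
  have := quad_diagonal (fun _ : ι => (1 : ℝ)) y
  simpa [sqNorm] using this

lemma continuous_quad {X : Type*} [TopologicalSpace X] {A : X → Matrix ι ι ℂ}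
    {y : X → ι → κ → ℂ} (hA : Continuous A) (hy : Continuous y) :
    Continuous fun x => quad (A x) (y x) := by
  unfold quad
  have h : Continuous fun x => (Matrix.of (y x) : Matrix ι κ ℂ) := hy
  exact Complex.continuous_re.comp
    (((h.matrix_conjTranspose.matrix_mul hA).matrix_mul h).matrix_trace)

end QuadraticForm

/-! ### Densities with a general covariance, and the law of signal plus noise -/

section GaussianDensity

open scoped ComplexOrder

variable {ι κ : Type*} [Fintype ι] [Fintype κ] [DecidableEq ι]

/-- The density of an array with i.i.d. columns of law `CN(0, F)`. -/
noncomputable def gaussDensity (F : Matrix ι ι ℂ) (y : ι → κ → ℂ) : ℝ :=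
  (Real.pi ^ (Fintype.card ι * Fintype.card κ))⁻¹ * (F.det.re ^ Fintype.card κ)⁻¹ *
    Real.exp (-quad F⁻¹ y)

lemma det_mul_conjTranspose_re (R : Matrix ι ι ℂ) : (R * Rᴴ).det.re = ‖R.det‖ ^ 2 := by
  rw [Matrix.det_mul, Matrix.det_conjTranspose, Complex.star_def, Complex.mul_conj',
    ← Complex.ofReal_pow, Complex.ofReal_re]

lemma conjTranspose_mul_inv_mul_self {R : Matrix ι ι ℂ} (hR : R.det ≠ 0) :
    Rᴴ * (R * Rᴴ)⁻¹ * R = 1 := by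
  have hu : IsUnit R.det := isUnit_iff_ne_zero.2 hR
  have hu' : IsUnit Rᴴ.det := by rw [Matrix.det_conjTranspose]; exact hu.star
  rw [Matrix.mul_inv_rev, ← Matrix.mul_assoc, Matrix.mul_nonsing_inv _ hu', Matrix.one_mul,
    Matrix.nonsing_inv_mul _ hu]

lemma gaussDensity_lmul {R : Matrix ι ι ℂ} (hR : R.det ≠ 0) (y : ι → κ → ℂ) :
    gaussDensity (R * Rᴴ) (lmul R y) =
      ((‖R.det‖ ^ 2) ^ Fintype.card κ)⁻¹ * stdDensity y := by
  rw [gaussDensity, quad_lmul, conjTranspose_mul_inv_mul_self hR, quad_one,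
    det_mul_conjTranspose_re, stdDensity]
  ring

lemma continuous_gaussDensity (F : Matrix ι ι ℂ) :
    Continuous (gaussDensity F : (ι → κ → ℂ) → ℝ) := by
  unfold gaussDensity
  exact continuous_const.mul (Real.continuous_exp.comp
    (continuous_quad continuous_const continuous_id).neg)

/-- The law of an array with i.i.d. columns of law `CN(0, R Rᴴ)`. -/
lemma lintegral_gaussDensity {R : Matrix ι ι ℂ} (hR : R.det ≠ 0) {f : (ι → κ → ℂ) → ℝ≥0∞}
    (hf : Measurable f) :
    ∫⁻ y, ENNReal.ofReal (gaussDensity (R * Rᴴ) y) * f y = ∫⁻ y, f (lmul R y) ∂stdArray ι κ := by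
  have hd : 0 < ((‖R.det‖ ^ 2) ^ Fintype.card κ) := by
    have := norm_pos_iff.2 hR
    positivity
  have hfR : Measurable fun y => f (lmul R y) := hf.comp (continuous_lmul R).measurable
  have hcv := lintegral_comp_lmul (κ := κ) hR
    (f := fun y => ENNReal.ofReal (gaussDensity (R * Rᴴ) y) * f y)
    ((continuous_gaussDensity _).measurable.ennreal_ofReal.mul hf)
  simp_rw [gaussDensity_lmul hR, ENNReal.ofReal_mul (inv_nonneg.2 hd.le), mul_assoc] at hcv
  rw [lintegral_const_mul' _ _ ENNReal.ofReal_ne_top] at hcv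
  rw [lintegral_stdArray hfR]
  refine ((ENNReal.mul_right_inj ?_ ENNReal.ofReal_ne_top).1 hcv).symm
  exact (ENNReal.ofReal_pos.2 (inv_pos.2 hd)).ne'

/-- Write `D = R Rᴴ`. Then `quad D y` is the squared norm of `Rᴴ y`, and the substitution `y ↦ Rᴴ y`
reduces to the total mass of the standard density. -/
lemma lintegral_exp_neg_quad {D : Matrix ι ι ℂ} (hD : D.PosDef) :
    ∫⁻ y : ι → κ → ℂ, ENNReal.ofReal
        ((Real.pi ^ (Fintype.card ι * Fintype.card κ))⁻¹ * Real.exp (-quad D y)) =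
      ENNReal.ofReal (D.det.re ^ Fintype.card κ)⁻¹ := by
  obtain ⟨R, hR, hRD⟩ := exists_mul_conjTranspose_of_posDef hD
  have hR' : Rᴴ.det ≠ 0 := by rw [Matrix.det_conjTranspose]; exact star_ne_zero.2 hR
  have h := lintegral_comp_lmul (κ := κ) hR' (f := fun y => ENNReal.ofReal (stdDensity y))
    continuous_stdDensity.measurable.ennreal_ofReal
  rw [lintegral_stdDensity, mul_one] at h
  rw [hRD, det_mul_conjTranspose_re, ← norm_star R.det, ← Matrix.det_conjTranspose, ← h]
  simp only [stdDensity, ← quad_one, quad_lmul, Matrix.mul_one, Matrix.conjTranspose_conjTranspose]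

variable {ι' : Type*} [Fintype ι'] [DecidableEq ι']

lemma posDef_one_add_conjTranspose_mul_self (X : Matrix ι ι' ℂ) : (1 + Xᴴ * X).PosDef :=
  Matrix.PosDef.one.add_posSemidef (Matrix.posSemidef_conjTranspose_mul_self X)

lemma posDef_one_add_mul_conjTranspose_self (X : Matrix ι ι' ℂ) : (1 + X * Xᴴ).PosDef :=
  Matrix.PosDef.one.add_posSemidef (Matrix.posSemidef_self_mul_conjTranspose X)

/-- The Woodbury identity. It identifies what remains after completing the square in the fading
coefficients as the quadratic form of the inverse covariance. -/
lemma inv_one_add_mul_conjTranspose_self (X : Matrix ι ι' ℂ) :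
    (1 + X * Xᴴ)⁻¹ = 1 - X * (1 + Xᴴ * X)⁻¹ * Xᴴ := by
  have hu : IsUnit (1 + Xᴴ * X).det :=
    isUnit_iff_ne_zero.2 (posDef_one_add_conjTranspose_mul_self X).det_pos.ne'
  refine Matrix.inv_eq_right_inv ?_
  have h : X * Xᴴ = X * ((1 + Xᴴ * X) * (1 + Xᴴ * X)⁻¹) * Xᴴ := by
    rw [Matrix.mul_nonsing_inv _ hu, Matrix.mul_one]
  have h2 : X * ((1 + Xᴴ * X) * (1 + Xᴴ * X)⁻¹) * Xᴴ =
      X * (1 + Xᴴ * X)⁻¹ * Xᴴ + X * Xᴴ * (X * (1 + Xᴴ * X)⁻¹ * Xᴴ) := by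
    simp only [Matrix.add_mul, Matrix.mul_add, Matrix.mul_assoc, Matrix.one_mul]
  rw [Matrix.add_mul, Matrix.one_mul, Matrix.mul_sub, Matrix.mul_one]
  nth_rewrite 1 [h]
  rw [h2]
  abel

/-- Completing the square in the joint density of the fading coefficients and the noise. -/
lemma sqNorm_add_sqNorm_sub (X : Matrix ι ι' ℂ) (h : ι' → κ → ℂ) (y : ι → κ → ℂ) :
    sqNorm h + sqNorm (y - lmul X h) =
      quad (1 + Xᴴ * X) (h - lmul ((1 + Xᴴ * X)⁻¹ * Xᴴ) y) + quad (1 + X * Xᴴ)⁻¹ y := by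
  have hA := posDef_one_add_conjTranspose_mul_self X
  have hu : IsUnit (1 + Xᴴ * X).det := isUnit_iff_ne_zero.2 hA.det_pos.ne'
  rw [inv_one_add_mul_conjTranspose_self, ← quad_one h, ← quad_one]
  set A := 1 + Xᴴ * X with hAdef
  have hAH : A⁻¹ᴴ = A⁻¹ := by rw [Matrix.conjTranspose_nonsing_inv, hA.1]
  simp only [quad, of_lmul, ← Matrix.of_sub_of]
  generalize (Matrix.of h : Matrix ι' κ ℂ) = h
  generalize (Matrix.of y : Matrix ι κ ℂ) = y
  rw [← Complex.add_re, ← Complex.add_re, ← Matrix.trace_add, ← Matrix.trace_add]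
  congr 2
  simp only [Matrix.conjTranspose_sub, Matrix.conjTranspose_mul, Matrix.conjTranspose_conjTranspose,
    hAH]
  have e1 : (hᴴ - yᴴ * (X * A⁻¹)) * A * (h - A⁻¹ * Xᴴ * y) =
      hᴴ * A * h - hᴴ * (A * A⁻¹) * Xᴴ * y - yᴴ * X * (A⁻¹ * A) * h +
        yᴴ * X * (A⁻¹ * A) * A⁻¹ * Xᴴ * y := by
    simp only [Matrix.sub_mul, Matrix.mul_sub, Matrix.mul_assoc]
    abel
  rw [e1, Matrix.mul_nonsing_inv _ hu, Matrix.nonsing_inv_mul _ hu, hAdef]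
  simp only [Matrix.sub_mul, Matrix.mul_sub, Matrix.mul_assoc, Matrix.mul_one,
    Matrix.add_mul, Matrix.mul_add]
  abel

/-- The law of a linear image of a standard Gaussian array plus standard Gaussian noise. -/
lemma lintegral_lmul_add (X : Matrix ι ι' ℂ) {f : (ι → κ → ℂ) → ℝ≥0∞} (hf : Measurable f) :
    ∫⁻ p, f (lmul X p.1 + p.2) ∂((stdArray ι' κ).prod (stdArray ι κ)) =
      ∫⁻ y, ENNReal.ofReal (gaussDensity (1 + X * Xᴴ) y) * f y := by
  have hm : Measurable fun p : (ι' → κ → ℂ) × (ι → κ → ℂ) => f (lmul X p.1 + p.2) :=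
    hf.comp (((continuous_lmul X).comp continuous_fst).add continuous_snd).measurable
  have hs : Measurable fun p : (ι' → κ → ℂ) × (ι → κ → ℂ) =>
      ENNReal.ofReal (stdDensity p.1) * (ENNReal.ofReal (stdDensity (p.2 - lmul X p.1)) * f p.2) :=
    ((continuous_stdDensity.comp continuous_fst).measurable.ennreal_ofReal).mul
      ((continuous_stdDensity.comp (continuous_snd.sub
        ((continuous_lmul X).comp continuous_fst))).measurable.ennreal_ofReal.mul
        (hf.comp measurable_snd))
  rw [lintegral_prod _ hm.aemeasurable, lintegral_stdArray hm.lintegral_prod_right']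
  -- For fixed fading `h`, translating the noise by `X h` makes the received array `y` the variable
  -- of integration.
  have h1 : ∀ h : ι' → κ → ℂ, ENNReal.ofReal (stdDensity h) *
      ∫⁻ z, f (lmul X h + z) ∂stdArray ι κ = ∫⁻ y, ENNReal.ofReal (stdDensity h) *
        (ENNReal.ofReal (stdDensity (y - lmul X h)) * f y) := by
    intro h
    rw [lintegral_const_mul' _ _ ENNReal.ofReal_ne_top, lintegral_stdArray
      (f := fun z => f (lmul X h + z))
        (hf.comp (measurable_const.add measurable_id)),
      ← lintegral_add_left_eq_self (μ := (volume : Measure (ι → κ → ℂ)))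
        (fun y => ENNReal.ofReal (stdDensity (y - lmul X h)) * f y) (lmul X h)]
    simp only [add_sub_cancel_left]
  simp_rw [h1]
  -- With `y` outside, completing the square leaves a translated Gaussian integral in `h`, equal to
  -- a power of `det (1 + Xᴴ X)⁻¹`. By Sylvester's identity `det (1 + Xᴴ X) = det (1 + X Xᴴ)`, this
  -- is the normalization of `gaussDensity`.
  rw [lintegral_lintegral_swap hs.aemeasurable]
  refine lintegral_congr fun y => ?_
  have h2 : ∀ h : ι' → κ → ℂ, ENNReal.ofReal (stdDensity h) *
      (ENNReal.ofReal (stdDensity (y - lmul X h)) * f y) =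
      ENNReal.ofReal ((Real.pi ^ (Fintype.card ι' * Fintype.card κ))⁻¹ *
        Real.exp (-quad (1 + Xᴴ * X) (h - lmul ((1 + Xᴴ * X)⁻¹ * Xᴴ) y))) *
      (ENNReal.ofReal ((Real.pi ^ (Fintype.card ι * Fintype.card κ))⁻¹ *
        Real.exp (-quad (1 + X * Xᴴ)⁻¹ y)) * f y) := by
    intro h
    rw [← mul_assoc, ← mul_assoc, ← ENNReal.ofReal_mul (stdDensity_nonneg _),
      ← ENNReal.ofReal_mul (by positivity)]
    congr 2
    rw [stdDensity, stdDensity, mul_mul_mul_comm, ← Real.exp_add, ← neg_add,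
      sqNorm_add_sqNorm_sub, neg_add, Real.exp_add]
    ring
  simp_rw [h2]
  rw [lintegral_mul_const _ (by
      refine Measurable.ennreal_ofReal (Continuous.measurable ?_)
      exact continuous_const.mul (Real.continuous_exp.comp (continuous_quad continuous_const
        (continuous_id.sub continuous_const)).neg)),
    lintegral_sub_right_eq_self (μ := (volume : Measure (ι' → κ → ℂ)))
      (fun h => ENNReal.ofReal ((Real.pi ^ (Fintype.card ι' * Fintype.card κ))⁻¹ *
        Real.exp (-quad (1 + Xᴴ * X) h))),
    lintegral_exp_neg_quad (posDef_one_add_conjTranspose_mul_self X), ← mul_assoc,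
    ← ENNReal.ofReal_mul (inv_nonneg.2 (pow_nonneg
      (Complex.pos_iff.1 (posDef_one_add_conjTranspose_mul_self X).det_pos).1.le _)),
    ← Matrix.det_one_add_mul_comm]
  congr 2
  rw [gaussDensity]
  ring

end GaussianDensity

/-! ### The squared norm of a standard Gaussian array has a Gamma law -/

section RadialLaw

variable {ι κ : Type*} [Fintype ι] [Fintype κ]

/-- Arrays as vectors of a Euclidean space. -/
noncomputable def arrayEquiv (ι κ : Type*) [Fintype ι] [Fintype κ] :
    (ι → κ → ℂ) ≃L[ℝ] EuclideanSpace ℂ (ι × κ) :=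
  ((LinearEquiv.curry ℝ ℂ ι κ).symm.trans
    (WithLp.linearEquiv 2 ℝ (ι × κ → ℂ)).symm).toContinuousLinearEquiv

lemma norm_arrayEquiv_sq (y : ι → κ → ℂ) : ‖arrayEquiv ι κ y‖ ^ 2 = sqNorm y := by
  rw [EuclideanSpace.norm_sq_eq, Fintype.sum_prod_type]
  rfl

/-- The squared norm of a standard Gaussian array has a Gamma distribution, up to a constant. -/
lemma exists_stdArray_real_sqNorm_mem [Nonempty ι] [Nonempty κ] :
    ∃ K : ℝ, ∀ S : Set ℝ, MeasurableSet S → (stdArray ι κ).real {y | sqNorm y ∈ S} =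
      K * ∫ s in Set.Ioi 0 ∩ S, s ^ (((Fintype.card ι * Fintype.card κ : ℕ) : ℝ) - 1) *
        Real.exp (-s) := by
  set N := Fintype.card ι * Fintype.card κ with hN
  have hN0 : 1 ≤ N := Nat.mul_pos Fintype.card_pos Fintype.card_pos
  set μ := (volume : Measure (ι → κ → ℂ)).map (arrayEquiv ι κ)
  have : μ.IsAddHaarMeasure := (arrayEquiv ι κ).isAddHaarMeasure_map _
  have hdim : Module.finrank ℝ (EuclideanSpace ℂ (ι × κ)) = 2 * N := by
    rw [← (arrayEquiv ι κ).toLinearEquiv.finrank_eq]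
    rw [Module.finrank_pi_fintype]
    simp only [Module.finrank_pi_fintype, Complex.finrank_real_complex, Finset.sum_const,
      Finset.card_univ, smul_eq_mul, hN]
    ring
  refine ⟨μ.real (Metric.ball 0 1) * N * (Real.pi ^ N)⁻¹, fun S hS => ?_⟩
  have hmeas : MeasurableSet {y : ι → κ → ℂ | sqNorm y ∈ S} :=
    continuous_sqNorm.measurable hS
  set g : ℝ → ℝ := fun s => S.indicator (fun s => (Real.pi ^ N)⁻¹ * Real.exp (-s)) s with hg
  have h1 : (stdArray ι κ).real {y | sqNorm y ∈ S} = ∫ y : ι → κ → ℂ, g (sqNorm y) := by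
    rw [measureReal_def, stdArray_eq_withDensity, withDensity_apply _ hmeas,
      ← integral_eq_lintegral_of_nonneg_ae (ae_of_all _ stdDensity_nonneg)
        continuous_stdDensity.aestronglyMeasurable, ← integral_indicator hmeas]
    refine integral_congr_ae (ae_of_all _ fun y => ?_)
    by_cases hy : sqNorm y ∈ S
    · rw [Set.indicator_of_mem (by exact hy)]
      simp only [hg, Set.indicator_of_mem hy]
      rfl
    · rw [Set.indicator_of_notMem (by exact hy)]
      simp only [hg, Set.indicator_of_notMem hy]
  have h2 : ∫ y : ι → κ → ℂ, g (sqNorm y) = ∫ x, g (‖x‖ ^ 2) ∂μ := by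
    have hemb : MeasurableEmbedding (arrayEquiv ι κ) :=
      (arrayEquiv ι κ).toHomeomorph.measurableEmbedding
    rw [hemb.integral_map]
    refine integral_congr_ae (ae_of_all _ fun y => ?_)
    exact congrArg g (norm_arrayEquiv_sq y).symm
  rw [h1, h2, integral_fun_norm_addHaar μ (fun r => g (r ^ 2)), hdim]
  -- The substitution `s = y ^ 2`: the real dimension is `2 N`, so the radial weight `y ^ (2 N - 1)
  -- dy` becomes `s ^ (N - 1) ds / 2`.
  have h3 : ∫ y in Set.Ioi (0 : ℝ), y ^ (2 * N - 1) • g (y ^ 2) =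
      2⁻¹ * ∫ s in Set.Ioi (0 : ℝ), s ^ ((N : ℝ) - 1) * g s := by
    rw [← integral_comp_rpow_Ioi_of_pos (g := fun s => s ^ ((N : ℝ) - 1) * g s) two_pos,
      ← integral_const_mul]
    refine setIntegral_congr_fun measurableSet_Ioi fun y hy => ?_
    have hy0 : (0 : ℝ) < y := hy
    simp only [smul_eq_mul, Real.rpow_two]
    rw [← Real.rpow_natCast_mul hy0.le 2, ← Real.rpow_natCast y (2 * N - 1),
      Nat.cast_sub (by omega)]
    have : y ^ (((2 * N : ℕ) : ℝ) - ((1 : ℕ) : ℝ)) =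
        y ^ ((2 : ℝ) - 1) * y ^ (((2 : ℕ) : ℝ) * ((N : ℝ) - 1)) := by
      rw [← Real.rpow_add hy0]
      congr 1
      push_cast
      ring
    rw [this]
    ring
  have h4 : ∫ s in Set.Ioi (0 : ℝ), s ^ ((N : ℝ) - 1) * g s =
      (Real.pi ^ N)⁻¹ * ∫ s in Set.Ioi 0 ∩ S, s ^ ((N : ℝ) - 1) * Real.exp (-s) := by
    rw [Set.inter_comm, ← Measure.restrict_restrict hS, ← integral_indicator hS,
      ← integral_const_mul]
    refine integral_congr_ae (ae_of_all _ fun s => ?_)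
    by_cases hs : s ∈ S
    · simp only [hg, Set.indicator_of_mem hs]
      ring
    · simp only [hg, Set.indicator_of_notMem hs, mul_zero]
  rw [h3, h4]
  simp only [nsmul_eq_mul, smul_eq_mul]
  push_cast
  ring

/-- The unknown constant follows from the total mass: for `S = univ` the formula says that `1 = K
Γ(N)`, so no volume of a ball has to be computed. -/
lemma stdArray_real_sqNorm_mem [Nonempty ι] [Nonempty κ] {S : Set ℝ} (hS : MeasurableSet S) :
    (stdArray ι κ).real {y | sqNorm y ∈ S} =
      (∫ s in Set.Ioi 0 ∩ S, s ^ (((Fintype.card ι * Fintype.card κ : ℕ) : ℝ) - 1) *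
        Real.exp (-s)) / Real.Gamma ((Fintype.card ι * Fintype.card κ : ℕ) : ℝ) := by
  obtain ⟨K, hK⟩ := exists_stdArray_real_sqNorm_mem (ι := ι) (κ := κ)
  have hpos : (0 : ℝ) < ((Fintype.card ι * Fintype.card κ : ℕ) : ℝ) := by
    exact_mod_cast Nat.mul_pos Fintype.card_pos Fintype.card_pos
  have h1 := hK Set.univ MeasurableSet.univ
  have hG : ∫ s in Set.Ioi (0 : ℝ), s ^ (((Fintype.card ι * Fintype.card κ : ℕ) : ℝ) - 1) *
      Real.exp (-s) = Real.Gamma ((Fintype.card ι * Fintype.card κ : ℕ) : ℝ) := by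
    rw [Real.Gamma_eq_integral hpos]
    simp only [mul_comm]
  rw [Set.inter_univ, hG] at h1
  simp only [Set.mem_univ, Set.ofPred_true, probReal_univ] at h1
  rw [hK S hS, eq_div_iff (Real.Gamma_pos_of_pos hpos).ne', mul_right_comm, ← h1, one_mul]

lemma stdArray_lt_sqNorm [Nonempty ι] [Nonempty κ] {a : ℝ} (ha : 0 ≤ a) :
    stdArray ι κ {y | a < sqNorm y} =
      ENNReal.ofReal (upperGamma ((Fintype.card ι * Fintype.card κ : ℕ) : ℝ) a /
        Real.Gamma ((Fintype.card ι * Fintype.card κ : ℕ) : ℝ)) := by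
  have := stdArray_real_sqNorm_mem (ι := ι) (κ := κ) (measurableSet_Ioi (a := a))
  rw [Set.inter_eq_right.2 (Set.Ioi_subset_Ioi ha)] at this
  rw [upperGamma, ← this, ofReal_measureReal]
  rfl

lemma stdArray_sqNorm_le [Nonempty ι] [Nonempty κ] (a : ℝ) :
    stdArray ι κ {y | sqNorm y ≤ a} =
      ENNReal.ofReal (lowerGamma ((Fintype.card ι * Fintype.card κ : ℕ) : ℝ) a /
        Real.Gamma ((Fintype.card ι * Fintype.card κ : ℕ) : ℝ)) := by
  have := stdArray_real_sqNorm_mem (ι := ι) (κ := κ) (measurableSet_Iic (a := a))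
  rw [Set.Ioi_inter_Iic] at this
  rw [lowerGamma, ← this, ofReal_measureReal]
  rfl

end RadialLaw

/-! ### Okamoto's inequality for weighted sums of squares -/

section Ellipsoid

variable {ι κ : Type*} [Fintype ι] [Fintype κ] [DecidableEq ι]

/-- Among the sets of a given volume, a centered ball has the largest standard Gaussian
measure. -/
lemma stdArray_le_of_volume_eq {A : Set (ι → κ → ℂ)} (hA : MeasurableSet A) {r : ℝ}
    (hvol : volume A = volume {y : ι → κ → ℂ | sqNorm y ≤ r}) :
    stdArray ι κ A ≤ stdArray ι κ {y | sqNorm y ≤ r} := by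
  set B := {y : ι → κ → ℂ | sqNorm y ≤ r} with hB
  have hBm : MeasurableSet B := measurableSet_le continuous_sqNorm.measurable measurable_const
  -- `φ` is the value of the density on the boundary of the ball. The density is at least `φ` on `B`
  -- and at most `φ` off it, so exchanging `B \ A` for the equally large `A \ B` can only lose mass.
  set φ : ℝ≥0∞ := ENNReal.ofReal
    ((Real.pi ^ (Fintype.card ι * Fintype.card κ))⁻¹ * Real.exp (-r)) with hφ
  have hφ0 : φ ≠ 0 := (ENNReal.ofReal_pos.2 (by positivity)).ne'
  have hin : ∀ s ⊆ B, MeasurableSet s → φ * volume s ≤ stdArray ι κ s := by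
    intro s hs hsm
    rw [stdArray_eq_withDensity, withDensity_apply _ hsm, ← setLIntegral_const]
    refine setLIntegral_mono' hsm fun y hy => ENNReal.ofReal_le_ofReal ?_
    exact mul_le_mul_of_nonneg_left (Real.exp_le_exp.2 (neg_le_neg (hs hy))) (by positivity)
  have hout : ∀ s ⊆ Bᶜ, MeasurableSet s → stdArray ι κ s ≤ φ * volume s := by
    intro s hs hsm
    rw [stdArray_eq_withDensity, withDensity_apply _ hsm, ← setLIntegral_const]
    refine setLIntegral_mono' hsm fun y hy => ENNReal.ofReal_le_ofReal ?_
    exact mul_le_mul_of_nonneg_left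
      (Real.exp_le_exp.2 (neg_le_neg (not_le.1 (Set.mem_compl_iff _ _ |>.1 (hs hy))).le)) (by positivity)
  have hBfin : volume B ≠ ∞ := by
    intro h
    have := hin B subset_rfl hBm
    rw [h, ENNReal.mul_top hφ0] at this
    exact measure_ne_top _ _ (top_le_iff.1 this)
  have hdiff : volume (A \ B) = volume (B \ A) := by
    have h1 := measure_inter_add_sdiff (μ := volume) A hBm
    have h2 := measure_inter_add_sdiff (μ := volume) B hA
    rw [hvol, ← h2, Set.inter_comm] at h1
    exact (ENNReal.add_right_inj (measure_ne_top_of_subset Set.inter_subset_left hBfin)).1 h1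
  rw [← measure_inter_add_sdiff A hBm, ← measure_inter_add_sdiff B hA, Set.inter_comm B A]
  refine add_le_add le_rfl ?_
  calc stdArray ι κ (A \ B) ≤ φ * volume (A \ B) := hout _ (fun y hy => hy.2) (hA.diff hBm)
    _ = φ * volume (B \ A) := by rw [hdiff]
    _ ≤ stdArray ι κ (B \ A) := hin _ Set.sdiff_subset (hBm.diff hA)

/-- Okamoto's inequality: replacing the weights by their geometric mean increases the distribution
function of a weighted sum of squared norms of Gaussian vectors. -/
lemma stdArray_weighted_le {d : ι → ℝ} (hd : ∀ i, 0 < d i) {g : ℝ} (hg : 0 < g)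
    (hgd : g ^ Fintype.card ι = ∏ i, d i) (c : ℝ) :
    stdArray ι κ {y | ∑ i, d i * ∑ l, ‖y i l‖ ^ 2 ≤ c} ≤
      stdArray ι κ {y | sqNorm y ≤ c / g} := by
  -- The ellipsoid is the preimage of the ball under `R`. As `g` is the geometric mean of the
  -- weights, `R` preserves volume.
  set R : Matrix ι ι ℂ := Matrix.diagonal fun i => ((Real.sqrt (d i / g) : ℝ) : ℂ) with hRdef
  have hnn : ∀ i, 0 ≤ d i / g := fun i => (div_pos (hd i) hg).le
  have hsq : R * R = Matrix.diagonal fun i => ((d i / g : ℝ) : ℂ) := diagonal_sqrt_mul_self hnn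
  have hRdet : ‖R.det‖ ^ 2 = 1 := by
    rw [sq, ← norm_mul, ← Matrix.det_mul, hsq, Matrix.det_diagonal, ← Complex.ofReal_prod,
      Finset.prod_div_distrib, Finset.prod_const, Finset.card_univ, hgd,
      div_self (Finset.prod_pos fun i _ => hd i).ne']
    simp
  have hR0 : R.det ≠ 0 := by
    intro h
    rw [h] at hRdet
    simp at hRdet
  have hset : {y : ι → κ → ℂ | ∑ i, d i * ∑ l, ‖y i l‖ ^ 2 ≤ c} =
      lmul R ⁻¹' {y | sqNorm y ≤ c / g} := by
    ext y
    simp only [Set.mem_ofPred_eq, Set.mem_preimage]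
    rw [← quad_one, quad_lmul, Matrix.mul_one, hRdef, diagonal_ofReal_conjTranspose, ← hRdef, hsq,
      quad_diagonal, le_div_iff₀ hg, Finset.sum_mul]
    refine iff_of_eq (congrArg (· ≤ c) (Finset.sum_congr rfl fun i _ => ?_))
    field_simp
  have hBm : MeasurableSet {y : ι → κ → ℂ | sqNorm y ≤ c / g} :=
    measurableSet_le continuous_sqNorm.measurable measurable_const
  rw [hset]
  refine stdArray_le_of_volume_eq ((continuous_lmul R).measurable hBm) ?_
  rw [← Measure.map_apply (continuous_lmul R).measurable hBm, map_lmul_volume hR0, hRdet]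
  simp

lemma stdArray_map_restrict (T : Finset ι) :
    (stdArray ι κ).map T.restrict = stdArray T κ := by
  unfold stdArray
  rw [← Measure.infinitePi_eq_pi, Measure.infinitePi_map_restrict]

/-- The rows outside `T` do not enter the event, so it can be computed in the marginal on `T`, where
all weights are positive. -/
lemma stdArray_weighted_subset_le {d : ι → ℝ} {T : Finset ι} (hT : T.Nonempty) [Nonempty κ]
    (hd : ∀ i ∈ T, 0 < d i) {g : ℝ} (hg : 0 < g) (hgd : g ^ T.card = ∏ i ∈ T, d i) (c : ℝ) :
    stdArray ι κ {y | ∑ i ∈ T, d i * ∑ l, ‖y i l‖ ^ 2 ≤ c} ≤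
      ENNReal.ofReal (lowerGamma ((T.card * Fintype.card κ : ℕ) : ℝ) (c / g) /
        Real.Gamma ((T.card * Fintype.card κ : ℕ) : ℝ)) := by
  have : Nonempty T := hT.to_subtype
  have hm : MeasurableSet {y : T → κ → ℂ | ∑ i : T, d i * ∑ l, ‖y i l‖ ^ 2 ≤ c} :=
    measurableSet_le (Continuous.measurable (by fun_prop)) measurable_const
  have h := stdArray_weighted_le (κ := κ) (d := fun i : T => d i) (fun i => hd i i.2) hg
    (by rw [Fintype.card_coe, hgd, Finset.prod_coe_sort]) c
  rw [stdArray_sqNorm_le, Fintype.card_coe, ← stdArray_map_restrict,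
    Measure.map_apply (Finset.measurable_restrict T) hm] at h
  refine le_of_eq_of_le (congrArg _ ?_) h
  ext y
  simp only [Set.mem_ofPred_eq, Set.mem_preimage, Finset.restrict]
  rw [Finset.sum_coe_sort T fun i => d i * ∑ l, ‖y i l‖ ^ 2]

end Ellipsoid

/-! ### The two bounds for a fixed codebook: inside and outside the good region -/

section GaussianLaw

open scoped ComplexOrder

variable {ι κ : Type*} [Fintype ι] [Fintype κ] [DecidableEq ι]

/-- The law of an array with i.i.d. columns of law `CN(0, F)`. -/
noncomputable def gaussLaw (κ : Type*) [Fintype κ] (F : Matrix ι ι ℂ) : Measure (ι → κ → ℂ) :=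
  volume.withDensity fun y => ENNReal.ofReal (gaussDensity F y)

lemma gaussLaw_apply (F : Matrix ι ι ℂ) {A : Set (ι → κ → ℂ)} (hA : MeasurableSet A) :
    gaussLaw κ F A = ∫⁻ y, ENNReal.ofReal (gaussDensity F y) * A.indicator 1 y := by
  rw [gaussLaw, withDensity_apply _ hA, ← lintegral_indicator hA]
  refine lintegral_congr fun y => ?_
  by_cases hy : y ∈ A <;> simp [hy]

lemma gaussLaw_mul_conjTranspose {R : Matrix ι ι ℂ} (hR : R.det ≠ 0) :
    gaussLaw κ (R * Rᴴ) = (stdArray ι κ).map (lmul R) := by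
  refine Measure.ext fun A hA => ?_
  have hm : Measurable (lmul R : (ι → κ → ℂ) → ι → κ → ℂ) := (continuous_lmul R).measurable
  rw [gaussLaw_apply _ hA, lintegral_gaussDensity hR (measurable_one.indicator hA),
    Measure.map_apply hm hA, ← lintegral_indicator_one (hm hA)]
  rfl

instance {F : Matrix ι ι ℂ} [hF : Fact F.PosDef] : IsProbabilityMeasure (gaussLaw κ F) := by
  obtain ⟨R, hR, rfl⟩ := exists_mul_conjTranspose_of_posDef hF.out
  rw [gaussLaw_mul_conjTranspose hR]
  exact Measure.isProbabilityMeasure_map (continuous_lmul R).measurable.aemeasurable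

lemma map_lmul_add {ι' : Type*} [Fintype ι'] [DecidableEq ι'] (X : Matrix ι ι' ℂ) :
    ((stdArray ι' κ).prod (stdArray ι κ)).map (fun p => lmul X p.1 + p.2) =
      gaussLaw κ (1 + X * Xᴴ) := by
  have hm : Measurable fun p : (ι' → κ → ℂ) × (ι → κ → ℂ) => lmul X p.1 + p.2 :=
    (((continuous_lmul X).comp continuous_fst).add continuous_snd).measurable
  refine Measure.ext fun A hA => ?_
  rw [gaussLaw_apply _ hA, ← lintegral_lmul_add X (measurable_one.indicator hA),
    Measure.map_apply hm hA, ← lintegral_indicator_one (hm hA)]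
  rfl

/-- The negative log-likelihood of the covariance matrix `F`, up to a constant. -/
noncomputable def metric (F : Matrix ι ι ℂ) (y : ι → κ → ℂ) : ℝ :=
  Fintype.card κ * Real.log F.det.re + quad F⁻¹ y

lemma continuous_metric (F : Matrix ι ι ℂ) : Continuous (metric F : (ι → κ → ℂ) → ℝ) :=
  continuous_const.add (continuous_quad continuous_const continuous_id)

/-- With `F = R Rᴴ`, the product `D F` has the spectrum of the Hermitian matrix `Rᴴ D R`, which is
congruent to `D`. This turns the condition on the eigenvalues of `B = D F` into convergence of the
Gaussian integral with exponent `-quad D`. -/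
lemma posDef_of_eigenvalues_mul_pos {n : ℕ} {D F : Matrix (Fin n) (Fin n) ℂ}
    (hD : D.IsHermitian) (hF : F.PosDef) (h : EigenvaluesPos (D * F)) : D.PosDef := by
  obtain ⟨R, hR, rfl⟩ := exists_mul_conjTranspose_of_posDef hF
  have hu : IsUnit R.det := isUnit_iff_ne_zero.2 hR
  have hS : (Rᴴ * D * R).IsHermitian := Matrix.isHermitian_conjTranspose_mul_mul _ hD
  have hspec : spectrum ℂ (Rᴴ * D * R) = spectrum ℂ (D * (R * Rᴴ)) := by
    ext z
    rw [Matrix.mem_spectrum_iff_isRoot_charpoly, Matrix.mem_spectrum_iff_isRoot_charpoly,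
      Matrix.mul_assoc, Matrix.charpoly_mul_comm, Matrix.mul_assoc]
  have hpos : (Rᴴ * D * R).PosDef := by
    rw [hS.posDef_iff_eigenvalues_pos]
    intro i
    have hi : ((hS.eigenvalues i : ℝ) : ℂ) ∈ spectrum ℂ (Rᴴ * D * R) := by
      rw [hS.spectrum_eq_image_range]
      exact ⟨_, ⟨i, rfl⟩, rfl⟩
    rw [hspec] at hi
    exact h _ hi
  exact (Matrix.IsUnit.posDef_star_left_conjugate_iff ((Matrix.isUnit_iff_isUnit_det R).2 hu)).1 hpos

lemma det_re_mul {A B : Matrix ι ι ℂ} (hA : A.PosDef) : (A * B).det.re = A.det.re * B.det.re := by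
  rw [Matrix.det_mul, Complex.mul_re, ← (Complex.pos_iff.1 hA.det_pos).2]
  ring

lemma det_re_pos {A : Matrix ι ι ℂ} (hA : A.PosDef) : 0 < A.det.re :=
  (Complex.pos_iff.1 hA.det_pos).1

/-- The Chernoff bound for the event that the wrong codewords have a smaller metric, inside the
region where the metric of the right ones is not too large. -/
lemma gaussLaw_metric_le {n L : ℕ} {F F₁ F' : Matrix (Fin n) (Fin n) ℂ} (hF : F.PosDef)
    (hF₁ : F₁.PosDef) (hF' : F'.PosDef) {u r ω ν : ℝ} (hu : 0 ≤ u) (hr : 0 ≤ r)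
    {B : Matrix (Fin n) (Fin n) ℂ}
    (hB : B = ((1 - u + r : ℝ) : ℂ) • (1 : Matrix (Fin n) (Fin n) ℂ) + (u : ℂ) • (F'⁻¹ * F)
      - ((r * ω : ℝ) : ℂ) • (F₁⁻¹ * F)) (hpos : EigenvaluesPos B) :
    gaussLaw (Fin L) F {y | metric F' y ≤ metric F y ∧
        metric F y ≤ ω * metric F₁ y + n * L * ν} ≤
      ENNReal.ofReal (Real.exp (L * r * n * ν) *
        Real.exp (L * ((u - r) * logDet F - u * logDet F' + r * ω * logDet F₁ - logDet B))) := by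
  -- `D` is the matrix of the quadratic form left in the exponent when the density is multiplied by
  -- both Chernoff factors; `B = D F` is its normalized version.
  set D : Matrix (Fin n) (Fin n) ℂ :=
    ((1 - u + r : ℝ) : ℂ) • F⁻¹ + (u : ℂ) • F'⁻¹ - ((r * ω : ℝ) : ℂ) • F₁⁻¹ with hD
  have hsm : ∀ (c : ℝ) {A : Matrix (Fin n) (Fin n) ℂ}, A.IsHermitian →
      ((c : ℂ) • A).IsHermitian := by
    intro c A hA
    rw [Matrix.IsHermitian, Matrix.conjTranspose_smul, hA, Complex.star_def, Complex.conj_ofReal]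
  have hDH : D.IsHermitian :=
    ((hsm _ hF.inv.1).add (hsm _ hF'.inv.1)).sub (hsm _ hF₁.inv.1)
  have hFu : IsUnit F.det := isUnit_iff_ne_zero.2 hF.det_pos.ne'
  have hBD : B = D * F := by
    rw [hB, hD, Matrix.sub_mul, Matrix.add_mul, Matrix.smul_mul, Matrix.smul_mul, Matrix.smul_mul,
      Matrix.nonsing_inv_mul _ hFu]
  have hDp : D.PosDef := posDef_of_eigenvalues_mul_pos hDH hF (hBD ▸ hpos)
  have hlogB : logDet B = Real.log D.det.re + logDet F := by
    rw [logDet, hBD, det_re_mul hDp, Real.log_mul (det_re_pos hDp).ne' (det_re_pos hF).ne', logDet]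
  have hm : MeasurableSet {y : Fin n → Fin L → ℂ | metric F' y ≤ metric F y ∧
      metric F y ≤ ω * metric F₁ y + n * L * ν} :=
    (measurableSet_le (continuous_metric F').measurable (continuous_metric F).measurable).inter
      (measurableSet_le (continuous_metric F).measurable
        ((continuous_const.mul (continuous_metric F₁)).add continuous_const).measurable)
  -- `E` collects the terms of the Chernoff exponent that do not depend on `y`.
  set E : ℝ := u * (L * logDet F - L * logDet F') +
    r * (ω * (L * logDet F₁) + n * L * ν - L * logDet F) with hE
  have hquad : ∀ y : Fin n → Fin L → ℂ, -quad F⁻¹ y + (u * (metric F y - metric F' y) +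
      r * (ω * metric F₁ y + n * L * ν - metric F y)) = E + -quad D y := by
    intro y
    rw [hD, quad_sub, quad_add, quad_smul, quad_smul, quad_smul, hE]
    simp only [metric, logDet, Fintype.card_fin]
    ring
  have hdF : (F.det.re ^ L)⁻¹ = Real.exp (-(L * logDet F)) := by
    rw [Real.exp_neg, Real.exp_nat_mul, logDet, Real.exp_log (det_re_pos hF)]
  have hdD : (D.det.re ^ L)⁻¹ = Real.exp (-(L * Real.log D.det.re)) := by
    rw [Real.exp_neg, Real.exp_nat_mul, Real.exp_log (det_re_pos hDp)]
  calc gaussLaw (Fin L) F _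
      ≤ ∫⁻ y : Fin n → Fin L → ℂ, ENNReal.ofReal ((F.det.re ^ L)⁻¹ * Real.exp E) *
          ENNReal.ofReal ((Real.pi ^ (Fintype.card (Fin n) * Fintype.card (Fin L)))⁻¹ *
            Real.exp (-quad D y)) := by
        rw [gaussLaw_apply _ hm]
        refine lintegral_mono fun y => ?_
        rw [← ENNReal.ofReal_mul (by have := det_re_pos hF; positivity)]
        by_cases hy : metric F' y ≤ metric F y ∧ metric F y ≤ ω * metric F₁ y + n * L * ν
        · rw [Set.indicator_of_mem (by exact hy), Pi.one_apply, mul_one]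
          refine ENNReal.ofReal_le_ofReal ?_
          -- On the event both brackets are nonnegative, so the exponential of this sum dominates
          -- the indicator.
          have h0 : 0 ≤ u * (metric F y - metric F' y) +
              r * (ω * metric F₁ y + n * L * ν - metric F y) :=
            add_nonneg (mul_nonneg hu (sub_nonneg.2 hy.1)) (mul_nonneg hr (sub_nonneg.2 hy.2))
          have h1 : Real.exp (-quad F⁻¹ y) ≤ Real.exp E * Real.exp (-quad D y) := by
            rw [← Real.exp_add, ← hquad y]
            exact Real.exp_le_exp.2 (le_add_of_nonneg_right h0)
          have h2 : 0 ≤ (Real.pi ^ (Fintype.card (Fin n) * Fintype.card (Fin L)))⁻¹ *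
              (F.det.re ^ L)⁻¹ := by
            have := det_re_pos hF
            positivity
          refine (mul_le_mul_of_nonneg_left h1 h2).trans_eq' ?_ |>.trans_eq (by ring)
          simp [gaussDensity]
        · rw [Set.indicator_of_notMem (by exact hy), mul_zero]
          exact zero_le
    _ = ENNReal.ofReal ((F.det.re ^ L)⁻¹ * Real.exp E * (D.det.re ^ L)⁻¹) := by
        rw [lintegral_const_mul' _ _ ENNReal.ofReal_ne_top, lintegral_exp_neg_quad hDp,
          ← ENNReal.ofReal_mul (by have := det_re_pos hF; positivity), Fintype.card_fin]
    _ = _ := by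
        rw [hdF, hdD, ← Real.exp_add, ← Real.exp_add, ← Real.exp_add, hlogB, hE]
        congr 2
        ring

/-- The largest `m` entries of a diagonal matrix. -/
lemma exists_take_sortedEigenvalues {n m : ℕ} (hmn : m ≤ n) {A : Matrix (Fin n) (Fin n) ℂ}
    {d : Fin n → ℝ} (hA : A.charpoly = (Matrix.diagonal fun i => (d i : ℂ)).charpoly) :
    ∃ T : Finset (Fin n), T.card = m ∧ ∀ f : ℝ → ℝ,
      (((sortedEigenvalues A).take m).map f).prod = ∏ i ∈ T, f (d i) := by
  -- `σ` lists the indices in decreasing order of `d`, and `T` will be the image of the first `m`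
  -- positions. Keeping track of indices rather than values makes repeated eigenvalues harmless.
  set σ := Tuple.sort (fun i => -d i) with hσ
  have hanti : Antitone (d ∘ σ) := by
    have := Tuple.monotone_sort (fun i => -d i)
    intro i j hij
    simpa using this hij
  have hroots : A.charpoly.roots.map Complex.re = ((List.ofFn (d ∘ σ) : List ℝ) : Multiset ℝ) := by
    rw [hA, Matrix.charpoly_diagonal, Polynomial.roots_prod _ _
      (Finset.prod_ne_zero_iff.2 fun i _ => Polynomial.X_sub_C_ne_zero _)]
    simp only [Polynomial.roots_X_sub_C, Multiset.bind_singleton, Multiset.map_map,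
      Function.comp_def, Complex.ofReal_re]
    rw [← Multiset.map_univ_val_equiv σ, Multiset.map_map, Fin.univ_val_map]
    rfl
  have hsort : sortedEigenvalues A = (List.finRange n).map (d ∘ σ) := by
    rw [sortedEigenvalues, hroots, Multiset.coe_sort, ← List.ofFn_eq_map]
    refine List.mergeSort_of_pairwise ?_
    simp_rw [decide_eq_true_eq, ← List.sortedGE_iff_pairwise]
    exact hanti.sortedGE_ofFn
  have hnd : (((List.finRange n).take m).map σ).Nodup :=
    ((List.nodup_finRange n).sublist (List.take_sublist _ _)).map σ.injective
  refine ⟨(((List.finRange n).take m).map σ).toFinset, ?_, fun f => ?_⟩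
  · rw [List.toFinset_card_of_nodup hnd]
    simp [hmn]
  · rw [List.prod_toFinset _ hnd, hsort, ← List.map_take]
    simp [Function.comp_def]

/-- The probability that the metric of the transmitted codewords is large. -/
lemma gaussLaw_metric_gt_le {n L m : ℕ} (hL : 1 ≤ L) (hm : 1 ≤ m) (hmn : m ≤ n)
    {F₁ K : Matrix (Fin n) (Fin n) ℂ} (hF₁ : F₁.PosDef) (hK : K.PosSemidef) {ω ν δ : ℝ}
    (hω : 0 ≤ ω) (hω1 : ω ≤ 1) (hδ : 0 ≤ δ) :
    gaussLaw (Fin L) (F₁ + K)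
        {y | ω * metric F₁ y + n * L * ν < metric (F₁ + K) y} ≤
      ENNReal.ofReal (upperGamma (n * L) (n * L * (1 + δ)) / Real.Gamma (n * L)) +
      ENNReal.ofReal (lowerGammaRatio (L * m)
        (L * (n * (1 + δ) * (1 - ω) - ω * logDet F₁ + logDet (F₁ + K) - n * ν))
        (ω * (((sortedEigenvalues (F₁⁻¹ * K)).take m).map fun x => x ^ (1 / (m : ℝ))).prod)) := by
  have : Nonempty (Fin n) := ⟨⟨0, by omega⟩⟩
  have : Nonempty (Fin L) := ⟨⟨0, by omega⟩⟩
  obtain ⟨R, d, hd, hR, hFR, hF₁R, hchar⟩ := exists_simultaneous_diagonalization hF₁ hK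
  obtain ⟨T, hTm, hT⟩ := exists_take_sortedEigenvalues hmn hchar
  rw [hT]
  set N : ℝ := L * (n * (1 + δ) * (1 - ω) - ω * logDet F₁ + logDet (F₁ + K) - n * ν) with hN
  set g : ℝ := ∏ i ∈ T, d i ^ (1 / (m : ℝ)) with hg
  have hmeas : MeasurableSet {y : Fin n → Fin L → ℂ |
      ω * metric F₁ y + n * L * ν < metric (F₁ + K) y} :=
    measurableSet_lt ((continuous_const.mul (continuous_metric F₁)).add continuous_const).measurable
      (continuous_metric _).measurable
  have hlaw : gaussLaw (Fin L) (F₁ + K) = (stdArray (Fin n) (Fin L)).map (lmul R) := by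
    rw [hFR, gaussLaw_mul_conjTranspose hR]
  rw [hlaw, Measure.map_apply (continuous_lmul R).measurable hmeas]
  have hm1 : ∀ y : Fin n → Fin L → ℂ,
      metric (F₁ + K) (lmul R y) = L * logDet (F₁ + K) + sqNorm y := by
    intro y
    rw [metric, Fintype.card_fin, logDet, quad_lmul, hFR, conjTranspose_mul_inv_mul_self hR,
      quad_one]
  have hm2 : ∀ y : Fin n → Fin L → ℂ,
      metric F₁ (lmul R y) = L * logDet F₁ + (sqNorm y + ∑ i, d i * ∑ l, ‖y i l‖ ^ 2) := by
    intro y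
    rw [metric, Fintype.card_fin, logDet, quad_lmul, hF₁R, quad_diagonal, sqNorm,
      ← Finset.sum_add_distrib]
    congr 1
    exact Finset.sum_congr rfl fun i _ => by ring
  have hnn : ∀ (y : Fin n → Fin L → ℂ) (i : Fin n), 0 ≤ d i * ∑ l, ‖y i l‖ ^ 2 := fun y i =>
    mul_nonneg (hd i) (Finset.sum_nonneg fun l _ => sq_nonneg _)
  -- In the whitened coordinates the event reads `ω ∑ dᵢ |yᵢ|² < (1 - ω) |y|² + const`. Bounding
  -- `|y|²` by `n L (1 + δ)` turns the right side into `N`, and dropping the indices outside `T`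
  -- only decreases the left side.
  have hsub : lmul R ⁻¹' {y : Fin n → Fin L → ℂ |
      ω * metric F₁ y + n * L * ν < metric (F₁ + K) y} ⊆
      {y | (n * L * (1 + δ) : ℝ) < sqNorm y} ∪ {y | ω * ∑ i ∈ T, d i * ∑ l, ‖y i l‖ ^ 2 < N} := by
    intro y hy
    rw [Set.mem_preimage, Set.mem_ofPred_eq, hm1, hm2] at hy
    by_cases hs : (n * L * (1 + δ) : ℝ) < sqNorm y
    · exact Or.inl hs
    · refine Or.inr ?_
      rw [Set.mem_ofPred_eq]
      have h1 : ∑ i ∈ T, d i * ∑ l, ‖y i l‖ ^ 2 ≤ ∑ i, d i * ∑ l, ‖y i l‖ ^ 2 :=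
        Finset.sum_le_univ_sum_of_nonneg (hnn y)
      have h2 := mul_le_mul_of_nonneg_left h1 hω
      have h3 := mul_le_mul_of_nonneg_left (not_lt.1 hs) (sub_nonneg.2 hω1)
      rw [hN]
      nlinarith
  refine (measure_mono hsub).trans ((measure_union_le _ _).trans (add_le_add ?_ ?_))
  · rw [stdArray_lt_sqNorm (by positivity)]
    simp
  -- For `N ≤ 0` the event is empty, since its left side is nonnegative. For `N > 0` and a zero
  -- denominator the ratio is `1` by convention and the bound is trivial.
  · rcases le_or_gt N 0 with hN0 | hN0
    · refine le_of_eq_of_le ?_ zero_le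
      refine measure_mono_null (t := ∅) (fun y hy => ?_) measure_empty
      have : 0 ≤ ω * ∑ i ∈ T, d i * ∑ l, ‖y i l‖ ^ 2 :=
        mul_nonneg hω (Finset.sum_nonneg fun i _ => hnn y i)
      rw [Set.mem_ofPred_eq] at hy
      exact absurd (this.trans_lt hy) (not_lt.2 hN0)
    · by_cases hD : ω * g = 0
      · rw [lowerGammaRatio, if_pos hD, if_pos hN0, ENNReal.ofReal_one]
        exact prob_le_one
      · rw [lowerGammaRatio, if_neg hD]
        have hω0 : 0 < ω := hω.lt_of_ne (fun h => hD (by rw [← h, zero_mul]))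
        have hg0 : g ≠ 0 := fun h => hD (by rw [h, mul_zero])
        have hm0 : (m : ℝ) ≠ 0 := by positivity
        -- A nonzero geometric mean forces all the selected eigenvalues to be positive, as Okamoto's
        -- inequality requires.
        have hdT : ∀ i ∈ T, 0 < d i := fun i hi => (hd i).lt_of_ne fun h => by
          refine Finset.prod_ne_zero_iff.1 hg0 i hi ?_
          rw [← h, Real.zero_rpow (one_div_ne_zero hm0)]
        have hgpos : 0 < g := Finset.prod_pos fun i hi => Real.rpow_pos_of_pos (hdT i hi) _
        have hgT : g ^ T.card = ∏ i ∈ T, d i := by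
          rw [hg, ← Finset.prod_pow]
          refine Finset.prod_congr rfl fun i hi => ?_
          rw [hTm, ← Real.rpow_natCast, ← Real.rpow_mul (hd i), one_div, inv_mul_cancel₀ hm0,
            Real.rpow_one]
        have key := stdArray_weighted_subset_le (κ := Fin L) (d := d) (T := T)
          (Finset.card_pos.1 (by omega)) hdT hgpos hgT (N / ω)
        rw [hTm, Fintype.card_fin, div_div, Nat.cast_mul, mul_comm (m : ℝ)] at key
        refine (measure_mono fun y hy => ?_).trans key
        rw [Set.mem_ofPred_eq] at hy ⊢
        rw [le_div_iff₀ hω0, mul_comm]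
        exact hy.le

end GaussianLaw

/-! ### Measurable choice of a minimizer -/

section Selection

/-- Candidates are added one at a time, each replacing the current choice where it is no worse.
Measurability of the current minimum is carried through the induction, because the next comparison
needs it. Both the maximum likelihood and the optimal decoder are obtained in this way. -/
lemma exists_measurable_argmin {α β γ : Type*} [MeasurableSpace α] [LinearOrder γ]
    [TopologicalSpace γ] [OrderClosedTopology γ] [SecondCountableTopology γ]
    [MeasurableSpace γ] [BorelSpace γ]
    {f : β → α → γ} {s : Finset β} (hs : s.Nonempty) (hf : ∀ b ∈ s, Measurable (f b)) :
    ∃ d : α → β, (∀ a, d a ∈ s) ∧ (∀ b, MeasurableSet (d ⁻¹' {b})) ∧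
      (∀ a, ∀ b ∈ s, f (d a) a ≤ f b a) ∧ Measurable fun a => f (d a) a := by
  classical
  induction hs using Finset.Nonempty.cons_induction with
  | singleton b₀ =>
    refine ⟨fun _ => b₀, fun _ => Finset.mem_singleton_self _, fun b => ?_, fun a b hb => ?_,
      hf b₀ (Finset.mem_singleton_self _)⟩
    · by_cases h : b₀ = b <;> simp [h]
    · rw [Finset.mem_singleton.1 hb]
  | cons b₀ s hb₀ hs ih =>
    obtain ⟨d, hds, hdm, hdf, hfm⟩ := ih fun b hb => hf b (Finset.mem_cons_of_mem hb)
    have hf₀ := hf b₀ (Finset.mem_cons_self _ _)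
    have hset : MeasurableSet {a | f b₀ a ≤ f (d a) a} := measurableSet_le hf₀ hfm
    refine ⟨fun a => if f b₀ a ≤ f (d a) a then b₀ else d a, fun a => ?_, fun b => ?_,
      fun a b hb => ?_, ?_⟩
    · dsimp only
      split_ifs
      · exact Finset.mem_cons_self _ _
      · exact Finset.mem_cons_of_mem (hds a)
    · have : (fun a => if f b₀ a ≤ f (d a) a then b₀ else d a) ⁻¹' {b} =
          ({a | f b₀ a ≤ f (d a) a} ∩ {_a | b₀ = b}) ∪
            ({a | f b₀ a ≤ f (d a) a}ᶜ ∩ d ⁻¹' {b}) := by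
        ext a
        by_cases h : f b₀ a ≤ f (d a) a <;> simp [h]
      rw [this]
      exact (hset.inter (MeasurableSet.const _)).union (hset.compl.inter (hdm b))
    · dsimp only
      rcases Finset.mem_cons.1 hb with rfl | hb
      · split_ifs with h
        · exact le_rfl
        · exact (not_le.1 h).le
      · split_ifs with h
        · exact h.trans (hdf a b hb)
        · exact hdf a b hb
    · have : (fun a => f (if f b₀ a ≤ f (d a) a then b₀ else d a) a) =
          fun a => if f b₀ a ≤ f (d a) a then f b₀ a else f (d a) a := by
        ext a
        split_ifs <;> rfl
      rw [this]
      exact Measurable.ite hset hf₀ hfm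

end Selection

/-! ### Continuity in the covariance matrix -/

section Continuity

open scoped ComplexOrder

variable {X ι κ : Type*} [TopologicalSpace X] [Fintype ι] [Fintype κ] [DecidableEq ι]
  {A : X → Matrix ι ι ℂ} {y : X → ι → κ → ℂ}

lemma continuous_inv_of_posDef (hA : Continuous A) (hp : ∀ x, (A x).PosDef) :
    Continuous fun x => (A x)⁻¹ := by
  simp only [Matrix.inv_def, Ring.inverse_eq_inv']
  exact (hA.matrix_det.inv₀ fun x => (hp x).det_pos.ne').smul hA.matrix_adjugate

lemma continuous_metric_comp (hA : Continuous A) (hp : ∀ x, (A x).PosDef) (hy : Continuous y) :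
    Continuous fun x => metric (A x) (y x) :=
  (continuous_const.mul ((Complex.continuous_re.comp hA.matrix_det).log
    fun x => (det_re_pos (hp x)).ne')).add (continuous_quad (continuous_inv_of_posDef hA hp) hy)

lemma continuous_gaussDensity_comp (hA : Continuous A) (hp : ∀ x, (A x).PosDef)
    (hy : Continuous y) : Continuous fun x => gaussDensity (A x) (y x) :=
  (continuous_const.mul (((Complex.continuous_re.comp hA.matrix_det).pow _).inv₀
    fun x => pow_ne_zero _ (det_re_pos (hp x)).ne')).mul
    (Real.continuous_exp.comp (continuous_quad (continuous_inv_of_posDef hA hp) hy).neg)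

end Continuity

/-! ### Covariance matrices of message vectors and of message sets -/

section Covariance

open scoped ComplexOrder

variable {n M Ka : ℕ}

/-- The matrix of the transmitted codewords. -/
def sentMat (x : Fin M → EuclideanSpace ℂ (Fin n)) (w : Fin Ka → Fin M) :
    Matrix (Fin n) (Fin Ka) ℂ :=
  Matrix.of fun i k => x (w k) i

/-- The covariance matrix of a column of the received signal. -/
noncomputable def sentCov (x : Fin M → EuclideanSpace ℂ (Fin n)) (w : Fin Ka → Fin M) :
    Matrix (Fin n) (Fin n) ℂ :=
  1 + sentMat x w * (sentMat x w)ᴴ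

lemma posDef_sentCov (x : Fin M → EuclideanSpace ℂ (Fin n)) (w : Fin Ka → Fin M) :
    (sentCov x w).PosDef := posDef_one_add_mul_conjTranspose_self _

lemma posDef_covMat (x : Fin M → EuclideanSpace ℂ (Fin n)) (S : Finset (Fin M)) :
    (covMat x S).PosDef := posDef_one_add_mul_conjTranspose_self _

instance (x : Fin M → EuclideanSpace ℂ (Fin n)) (w : Fin Ka → Fin M) :
    Fact (sentCov x w).PosDef := ⟨posDef_sentCov x w⟩

instance (x : Fin M → EuclideanSpace ℂ (Fin n)) (S : Finset (Fin M)) :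
    Fact (covMat x S).PosDef := ⟨posDef_covMat x S⟩

lemma subcode_mul_conjTranspose_apply (x : Fin M → EuclideanSpace ℂ (Fin n)) (S : Finset (Fin M))
    (i j : Fin n) : (subcode x S * (subcode x S)ᴴ) i j = ∑ k ∈ S, x k i * star (x k j) := by
  rw [Matrix.mul_apply, ← Finset.sum_coe_sort S]
  rfl

/-- A repeated message is counted with its multiplicity in `sentCov` but only once in `covMat`,
hence the injectivity assumption. -/
lemma sentCov_eq_covMat (x : Fin M → EuclideanSpace ℂ (Fin n)) {w : Fin Ka → Fin M}
    (hw : Function.Injective w) : sentCov x w = covMat x (Finset.univ.image w) := by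
  rw [sentCov, covMat]
  congr 1
  ext i j
  rw [subcode_mul_conjTranspose_apply, Finset.sum_image fun a _ b _ h => hw h, Matrix.mul_apply]
  rfl

lemma continuous_sentCov (w : Fin Ka → Fin M) :
    Continuous fun x : Fin M → EuclideanSpace ℂ (Fin n) => sentCov x w := by
  have : Continuous fun x : Fin M → EuclideanSpace ℂ (Fin n) => sentMat x w :=
    continuous_pi fun i => continuous_pi fun k => by unfold sentMat; fun_prop
  exact continuous_const.add (this.matrix_mul this.matrix_conjTranspose)

lemma continuous_covMat (S : Finset (Fin M)) :
    Continuous fun x : Fin M → EuclideanSpace ℂ (Fin n) => covMat x S := by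
  have : Continuous fun x : Fin M → EuclideanSpace ℂ (Fin n) => subcode x S :=
    continuous_pi fun i => continuous_pi fun k => by unfold subcode; fun_prop
  exact continuous_const.add (this.matrix_mul this.matrix_conjTranspose)

end Covariance

/-! ### The error probability of a codebook, the optimal decoder and compactness -/

section ErrorProbability

open scoped ComplexOrder

variable {n M L Ka : ℕ}

lemma received_eq (x : Fin M → EuclideanSpace ℂ (Fin n)) (w : Fin Ka → Fin M)
    (h : Fin Ka → Fin L → ℂ) (z : Fin n → Fin L → ℂ) :
    received x w h z = lmul (sentMat x w) h + z := by
  ext i l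
  rw [received, Pi.add_apply, Pi.add_apply, lmul_apply]
  congr 1
  exact Finset.sum_congr rfl fun k _ => mul_comm _ _

lemma map_received (x : Fin M → EuclideanSpace ℂ (Fin n)) (w : Fin Ka → Fin M) :
    ((stdArray (Fin Ka) (Fin L)).prod (stdArray (Fin n) (Fin L))).map
      (fun p => received x w p.1 p.2) = gaussLaw (Fin L) (sentCov x w) := by
  simp_rw [received_eq]
  exact map_lmul_add _

/-- Condition on the message vector: each `w` has probability `M⁻ᴷᵃ`, and given `w` the received
array has law `gaussLaw (sentCov x w)`, whether or not messages repeat. -/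
lemma jointErrorProb_eq_sum (hM : 0 < M) (x : Fin M → EuclideanSpace ℂ (Fin n))
    {dec : (Fin n → Fin L → ℂ) → Finset (Fin M)} (hdec : ∀ S, MeasurableSet (dec ⁻¹' {S})) :
    jointErrorProb (Ka := Ka) x dec = ∑ w : Fin Ka → Fin M, ((M : ℝ≥0∞)⁻¹) ^ Ka *
      gaussLaw (Fin L) (sentCov x w) {y | Finset.univ.image w ≠ dec y} := by
  have : Nonempty (Fin M) := ⟨⟨0, hM⟩⟩
  have : IsProbabilityMeasure (uniformOn (Set.univ : Set (Fin M))) :=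
    isProbabilityMeasure_uniformOn Set.finite_univ Set.univ_nonempty
  have hrec : ∀ w : Fin Ka → Fin M,
      Measurable fun p : (Fin Ka → Fin L → ℂ) × (Fin n → Fin L → ℂ) => received x w p.1 p.2 := by
    intro w
    simp_rw [received_eq]
    exact (((continuous_lmul _).comp continuous_fst).add continuous_snd).measurable
  have hA : ∀ w : Fin Ka → Fin M, MeasurableSet {y | Finset.univ.image w ≠ dec y} := by
    intro w
    convert (hdec (Finset.univ.image w)).compl using 1
    ext y
    simp [eq_comm]
  have hE : MeasurableSet {ω : (Fin Ka → Fin M) × (Fin Ka → Fin L → ℂ) × (Fin n → Fin L → ℂ) |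
      (Finset.univ.image ω.1 : Finset (Fin M)) ≠ dec (received x ω.1 ω.2.1 ω.2.2)} := by
    have : {ω : (Fin Ka → Fin M) × (Fin Ka → Fin L → ℂ) × (Fin n → Fin L → ℂ) |
        (Finset.univ.image ω.1 : Finset (Fin M)) ≠ dec (received x ω.1 ω.2.1 ω.2.2)} =
        ⋃ w : Fin Ka → Fin M, {w} ×ˢ ((fun p => received x w p.1 p.2) ⁻¹'
          {y | Finset.univ.image w ≠ dec y}) := by
      ext ⟨w, p⟩
      simp
    rw [this]
    exact MeasurableSet.iUnion fun w => (MeasurableSet.singleton w).prod (hrec w (hA w))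
  rw [jointErrorProb, channelLaw, Measure.prod_apply hE, lintegral_fintype]
  refine Finset.sum_congr rfl fun w _ => ?_
  rw [mul_comm, ← map_received, Measure.map_apply (hrec w) (hA w)]
  congr 1
  rw [Measure.pi_singleton]
  simp [uniformOn_univ]

/-- The total likelihood of the messages whose set differs from `S`. -/
noncomputable def bayesCost (x : Fin M → EuclideanSpace ℂ (Fin n)) (S : Finset (Fin M))
    (Ka : ℕ) (y : Fin n → Fin L → ℂ) : ℝ≥0∞ :=
  ∑ w : Fin Ka → Fin M,
    if Finset.univ.image w ≠ S then ENNReal.ofReal (gaussDensity (sentCov x w) y) else 0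

lemma continuous_bayesCost (S : Finset (Fin M)) (Ka : ℕ) :
    Continuous fun p : (Fin M → EuclideanSpace ℂ (Fin n)) × (Fin n → Fin L → ℂ) =>
      bayesCost p.1 S Ka p.2 := by
  refine continuous_finsetSum _ fun w _ => ?_
  split_ifs
  · exact ENNReal.continuous_ofReal.comp (continuous_gaussDensity_comp
      ((continuous_sentCov w).comp continuous_fst) (fun p => posDef_sentCov _ _) continuous_snd)
  · exact continuous_const

lemma jointErrorProb_eq_lintegral (hM : 0 < M) (x : Fin M → EuclideanSpace ℂ (Fin n))
    {dec : (Fin n → Fin L → ℂ) → Finset (Fin M)} (hdec : ∀ S, MeasurableSet (dec ⁻¹' {S})) :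
    jointErrorProb (Ka := Ka) x dec =
      ((M : ℝ≥0∞)⁻¹) ^ Ka * ∫⁻ y, bayesCost x (dec y) Ka y := by
  have hA : ∀ w : Fin Ka → Fin M, MeasurableSet {y | Finset.univ.image w ≠ dec y} := by
    intro w
    convert (hdec (Finset.univ.image w)).compl using 1
    ext y
    simp [eq_comm]
  rw [jointErrorProb_eq_sum hM x hdec, ← Finset.mul_sum]
  congr 1
  simp only [bayesCost]
  rw [lintegral_finsetSum]
  · refine Finset.sum_congr rfl fun w _ => ?_
    rw [gaussLaw, withDensity_apply _ (hA w), ← lintegral_indicator (hA w)]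
    refine lintegral_congr fun y => ?_
    simp only [Set.indicator_apply, Set.mem_ofPred_eq]
  · exact fun w _ => Measurable.ite (hA w)
      (continuous_gaussDensity _).measurable.ennreal_ofReal measurable_const

/-- The possible outputs of a decoder. -/
def decodable (M Ka : ℕ) : Finset (Finset (Fin M)) := Finset.univ.powersetCard Ka

lemma decodable_nonempty (hKa : Ka ≤ M) : (decodable M Ka).Nonempty := by
  rw [decodable, Finset.powersetCard_nonempty]
  simpa using hKa

/-- The smallest joint error probability with a given codebook. -/
noncomputable def bayesError (L Ka : ℕ) (x : Fin M → EuclideanSpace ℂ (Fin n)) : ℝ≥0∞ :=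
  ((M : ℝ≥0∞)⁻¹) ^ Ka *
    ∫⁻ y : Fin n → Fin L → ℂ, (decodable M Ka).inf fun S => bayesCost x S Ka y

lemma continuous_inf_bayesCost :
    Continuous fun p : (Fin M → EuclideanSpace ℂ (Fin n)) × (Fin n → Fin L → ℂ) =>
      (decodable M Ka).inf fun S => bayesCost p.1 S Ka p.2 :=
  Continuous.finset_inf_apply fun S _ => continuous_bayesCost S Ka

lemma bayesError_le (hM : 0 < M) (x : Fin M → EuclideanSpace ℂ (Fin n))
    {dec : (Fin n → Fin L → ℂ) → Finset (Fin M)} (hdec : ∀ S, MeasurableSet (dec ⁻¹' {S}))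
    (hcard : ∀ y, (dec y).card = Ka) : bayesError L Ka x ≤ jointErrorProb (Ka := Ka) x dec := by
  rw [jointErrorProb_eq_lintegral hM x hdec, bayesError]
  gcongr with y
  exact Finset.inf_le (Finset.mem_powersetCard_univ.2 (hcard y))

/-- For each received array, choosing a set of least `bayesCost` minimizes the integrand pointwise.
-/
lemma exists_decoder (hM : 0 < M) (hKa : Ka ≤ M) (x : Fin M → EuclideanSpace ℂ (Fin n)) :
    ∃ dec : (Fin n → Fin L → ℂ) → Finset (Fin M), (∀ S, MeasurableSet (dec ⁻¹' {S})) ∧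
      (∀ y, (dec y).card = Ka) ∧ jointErrorProb (Ka := Ka) x dec = bayesError L Ka x := by
  obtain ⟨dec, h1, h2, h3, -⟩ := exists_measurable_argmin
    (f := fun S (y : Fin n → Fin L → ℂ) => bayesCost x S Ka y) (decodable_nonempty hKa)
    fun S _ => ((continuous_bayesCost S Ka).comp
      (continuous_const.prodMk continuous_id)).measurable
  refine ⟨dec, h2, fun y => Finset.mem_powersetCard_univ.1 (h1 y), ?_⟩
  rw [jointErrorProb_eq_lintegral hM x h2, bayesError]
  congr 1
  exact lintegral_congr fun y => le_antisymm (Finset.le_inf fun S hS => h3 y S hS)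
    (Finset.inf_le (h1 y))

/-- Fatou's lemma along the neighbourhood filter of a codebook: for each received array the
integrand is continuous in the codebook. -/
lemma lowerSemicontinuous_bayesError (hM : 0 < M) : LowerSemicontinuous
    (bayesError L Ka : (Fin M → EuclideanSpace ℂ (Fin n)) → ℝ≥0∞) := by
  have hc := continuous_inf_bayesCost (n := n) (M := M) (L := L) (Ka := Ka)
  have h : LowerSemicontinuous fun x : Fin M → EuclideanSpace ℂ (Fin n) =>
      ∫⁻ y : Fin n → Fin L → ℂ, (decodable M Ka).inf fun S => bayesCost x S Ka y := by
    rw [lowerSemicontinuous_iff_le_liminf]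
    intro x
    refine le_trans (lintegral_mono fun y => ?_) (lintegral_liminf_le fun x' =>
      (hc.comp (continuous_const.prodMk continuous_id)).measurable)
    have ht : Filter.Tendsto (fun x' => (decodable M Ka).inf fun S => bayesCost x' S Ka y)
        (nhds x) (nhds ((decodable M Ka).inf fun S => bayesCost x S Ka y)) :=
      (hc.comp (continuous_id.prodMk continuous_const)).tendsto x
    exact ht.liminf_eq.ge
  have hcont : Continuous fun a : ℝ≥0∞ => ((M : ℝ≥0∞)⁻¹) ^ Ka * a :=
    ENNReal.continuous_const_mul (ENNReal.pow_ne_top (by simp; omega))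
  exact hcont.comp_lowerSemicontinuous h fun a b hab => mul_le_mul_right hab _

/-- If there are codebooks subject to the power constraint whose error probabilities come
arbitrarily close to `ε`, then there is a code that attains `ε`. -/
lemma nonempty_code (hM : 0 < M) (hKa : Ka ≤ M) {ε : ℝ≥0} {P : ℝ} (hP : 0 ≤ P)
    (h : ∀ η : ℝ≥0∞, (ε : ℝ≥0∞) < η → ∃ x : Fin M → EuclideanSpace ℂ (Fin n),
      (∀ m, ‖x m‖ ^ 2 ≤ n * P) ∧ bayesError L Ka x ≤ η) :
    Nonempty (Code n M L Ka ε P) := by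
  -- The power constraint describes a product of closed balls, which is compact, so the lower
  -- semicontinuous `bayesError` attains its minimum there. The minimum is below every `η > ε`,
  -- hence at most `ε`.
  set K : Set (Fin M → EuclideanSpace ℂ (Fin n)) :=
    Set.univ.pi fun _ => Metric.closedBall 0 (Real.sqrt (n * P)) with hK
  have hmem : ∀ x : Fin M → EuclideanSpace ℂ (Fin n), x ∈ K ↔ ∀ m, ‖x m‖ ^ 2 ≤ n * P := by
    intro x
    simp only [hK, Set.mem_pi, Set.mem_univ, true_imp_iff, mem_closedBall_zero_iff]
    exact forall_congr' fun m => Real.le_sqrt (norm_nonneg _) (by positivity)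
  obtain ⟨x, hxK, hx⟩ := LowerSemicontinuousOn.exists_isMinOn
    (s := K) ⟨0, (hmem 0).2 fun m => by simp; positivity⟩
    (isCompact_univ_pi fun _ => isCompact_closedBall _ _)
    ((lowerSemicontinuous_bayesError (L := L) (Ka := Ka) hM).lowerSemicontinuousOn K)
  obtain ⟨dec, hd1, hd2, hd3⟩ := exists_decoder (L := L) hM hKa x
  refine ⟨⟨x, dec, (hmem x).1 hxK, hd1, hd2, ?_⟩⟩
  rw [hd3]
  refine le_of_forall_gt_imp_ge_of_dense fun η hη => ?_
  obtain ⟨x', hx', hle⟩ := h η hη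
  exact (hx ((hmem x').2 hx')).trans hle

end ErrorProbability

/-! ### The random codebooks: exchangeability and power violation -/

section Ensembles

variable {n M : ℕ}

lemma isProbabilityMeasure_uniformSphere (hn : 1 ≤ n) :
    IsProbabilityMeasure (uniformSphere n) := by
  have : Nonempty (Fin n) := ⟨⟨0, by omega⟩⟩
  have : Nontrivial (EuclideanSpace ℂ (Fin n)) := inferInstance
  refine ⟨?_⟩
  rw [uniformSphere, Measure.smul_apply, smul_eq_mul]
  refine ENNReal.inv_mul_cancel (fun h => ?_) (measure_ne_top _ _)
  exact Measure.toSphere_ne_zero _ (Measure.measure_univ_eq_zero.1 h)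

lemma isProbabilityMeasure_codewordLaw (hn : 1 ≤ n) (P' : ℝ) (e : Ensemble) :
    IsProbabilityMeasure (codewordLaw n P' e) := by
  cases e
  · exact Measure.isProbabilityMeasure_map (by fun_prop)
  · have := isProbabilityMeasure_uniformSphere hn
    exact Measure.isProbabilityMeasure_map (by fun_prop)

lemma isProbabilityMeasure_codebookLaw (hn : 1 ≤ n) (P' : ℝ) (e : Ensemble) :
    IsProbabilityMeasure (codebookLaw n M P' e) := by
  have := isProbabilityMeasure_codewordLaw hn P' e
  unfold codebookLaw
  infer_instance

/-- The codewords are exchangeable. -/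
lemma measurePreserving_comp_perm (hn : 1 ≤ n) (P' : ℝ) (e : Ensemble) (σ : Equiv.Perm (Fin M)) :
    MeasurePreserving (fun C : Fin M → EuclideanSpace ℂ (Fin n) => C ∘ σ)
      (codebookLaw n M P' e) (codebookLaw n M P' e) := by
  have := isProbabilityMeasure_codewordLaw hn P' e
  exact measurePreserving_arrowCongr' (fun _ : Fin M => codewordLaw n P' e)
    (fun _ => codewordLaw n P' e) σ.symm (MeasurableEquiv.refl _) fun _ => MeasurePreserving.id _

lemma complexGaussian_eq_map (v : ℝ≥0) :
    complexGaussian v = (complexGaussian 1).map fun z => (Real.sqrt v : ℂ) * z := by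
  have hg : gaussianReal 0 (v / 2) = (gaussianReal 0 (1 / 2)).map (Real.sqrt v * ·) := by
    rw [gaussianReal_map_const_mul, mul_zero]
    congr 1
    ext
    simp [Real.sq_sqrt]
    ring
  rw [complexGaussian, complexGaussian, hg, Measure.map_prod_map _ _ (by fun_prop) (by fun_prop),
    Measure.map_map (MeasurableEquiv.measurable _) (by fun_prop),
    Measure.map_map (by fun_prop) (MeasurableEquiv.measurable _)]
  congr 1
  ext p
  apply Complex.ext <;> simp [Complex.measurableEquivRealProd_symm_apply]

/-- This writes a Gaussian codeword as a multiple of a standard array with one column, so that the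
Gamma law of `sqNorm` applies to its power. -/
lemma pi_complexGaussian_eq_map (v : ℝ≥0) :
    (Measure.pi fun _ : Fin n => complexGaussian v) =
      (stdArray (Fin n) Unit).map fun y i => (Real.sqrt v : ℂ) * y i () := by
  have h : ∀ _ : Fin n, complexGaussian v =
      (Measure.pi fun _ : Unit => complexGaussian 1).map fun u => (Real.sqrt v : ℂ) * u () := by
    intro _
    have := (measurePreserving_eval (fun _ : Unit => complexGaussian 1) ()).map_eq
    have hcomp := Measure.map_map (μ := Measure.pi fun _ : Unit => complexGaussian 1)
      (g := fun z : ℂ => (Real.sqrt v : ℂ) * z) (f := fun u : Unit → ℂ => u ())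
      (by fun_prop) (by fun_prop)
    rw [complexGaussian_eq_map]
    exact (congrArg _ this.symm).trans hcomp
  have hmeas : Measurable fun u : Unit → ℂ => (Real.sqrt v : ℂ) * u () :=
    measurable_const.mul (measurable_pi_apply _)
  have hp : ∀ _ : Fin n, IsProbabilityMeasure
      ((Measure.pi fun _ : Unit => complexGaussian 1).map fun u => (Real.sqrt v : ℂ) * u ()) :=
    fun _ => Measure.isProbabilityMeasure_map hmeas.aemeasurable
  rw [stdArray, Measure.pi_map_pi (f := fun (_ : Fin n) (u : Unit → ℂ) => (Real.sqrt v : ℂ) * u ())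
    fun _ => hmeas.aemeasurable]
  congr 1
  exact funext h

/-- The probability that a random codeword violates the power constraint. -/
lemma mul_codewordLaw_power_violation (hn : 1 ≤ n) (Ka : ℕ) {P P' : ℝ} {e : Ensemble}
    (hP' : P' ∈ powerRange P e) :
    (Ka : ℝ≥0∞) * codewordLaw n P' e {c | (n : ℝ) * P < ‖c‖ ^ 2} =
      ENNReal.ofReal (powerViolation n Ka P P' e) := by
  have hm : MeasurableSet {c : EuclideanSpace ℂ (Fin n) | (n : ℝ) * P < ‖c‖ ^ 2} :=
    measurableSet_lt measurable_const (by fun_prop)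
  cases e
  · obtain ⟨h0, hlt⟩ : 0 < P' ∧ P' < P := hP'
    have : Nonempty (Fin n) := ⟨⟨0, by omega⟩⟩
    have hset : (fun y : Fin n → Unit → ℂ => WithLp.toLp 2
        fun i => (Real.sqrt (P'.toNNReal : ℝ≥0) : ℂ) * y i ()) ⁻¹'
        {c : EuclideanSpace ℂ (Fin n) | (n : ℝ) * P < ‖c‖ ^ 2} =
        {y | (n : ℝ) * P / P' < sqNorm y} := by
      ext y
      simp only [Set.mem_preimage, Set.mem_ofPred_eq, EuclideanSpace.norm_sq_eq, norm_mul, mul_pow,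
        Complex.norm_real, Real.norm_eq_abs, sq_abs, Real.coe_toNNReal _ h0.le, Real.sq_sqrt h0.le,
        ← Finset.mul_sum, sqNorm, Finset.univ_unique, Finset.sum_singleton]
      rw [div_lt_iff₀ h0, mul_comm P']
    rw [codewordLaw, pi_complexGaussian_eq_map, Measure.map_map (by fun_prop) (by fun_prop),
      Measure.map_apply (by fun_prop) hm]
    change (Ka : ℝ≥0∞) * stdArray (Fin n) Unit ((fun y : Fin n → Unit → ℂ => WithLp.toLp 2
        fun i => (Real.sqrt (P'.toNNReal : ℝ≥0) : ℂ) * y i ()) ⁻¹'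
        {c : EuclideanSpace ℂ (Fin n) | (n : ℝ) * P < ‖c‖ ^ 2}) = _
    rw [hset, stdArray_lt_sqNorm (by have := h0.trans hlt; positivity), powerViolation,
      mul_div_assoc (Ka : ℝ),
      ENNReal.ofReal_mul (Nat.cast_nonneg _), ENNReal.ofReal_natCast]
    simp
  · obtain ⟨h0, hle⟩ : 0 < P' ∧ P' ≤ P := hP'
    rw [codewordLaw, Measure.map_apply (by fun_prop) hm, powerViolation, ENNReal.ofReal_zero]
    refine mul_eq_zero_of_right _ (measure_mono_null (t := ∅) (fun x hx => ?_) measure_empty)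
    rw [Set.mem_preimage, Set.mem_ofPred_eq] at hx
    -- On the sphere the power is exactly `n P' ≤ n P`, so a violation is impossible.
    refine (hx.not_ge ?_).elim
    rw [norm_smul, mem_sphere_zero_iff_norm.1 x.2, mul_one, Real.norm_eq_abs, sq_abs,
      Real.sq_sqrt (by positivity)]
    gcongr

end Ensembles

/-! ### Moving index sets by permutations -/

section Permutations

/-- Fibres over the same point have the same size, and bijections between them glue to a
permutation. -/
lemma exists_perm_comp_eq {α : Type*} [Fintype α] {γ : Type*} [DecidableEq γ] {f g : α → γ}
    (h : ∀ c, (Finset.univ.filter fun a => f a = c).card =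
      (Finset.univ.filter fun a => g a = c).card) : ∃ σ : Equiv.Perm α, ∀ a, g (σ a) = f a := by
  have e : ∀ c, Nonempty ({a // f a = c} ≃ {a // g a = c}) := fun c =>
    Fintype.card_eq.1 (by rw [Fintype.card_subtype, Fintype.card_subtype, h c])
  exact ⟨Equiv.ofFiberEquiv fun c => (e c).some, fun a => Equiv.ofFiberEquiv_map _ a⟩

/-- Three disjoint sets can be moved onto three others of the same sizes by a permutation. -/
lemma exists_perm_image_eq {α : Type*} [Fintype α] [DecidableEq α] {A₁ A₂ A₃ B₁ B₂ B₃ : Finset α} (hA₁₂ : Disjoint A₁ A₂)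
    (hA₁₃ : Disjoint A₁ A₃) (hA₂₃ : Disjoint A₂ A₃) (hB₁₂ : Disjoint B₁ B₂)
    (hB₁₃ : Disjoint B₁ B₃) (hB₂₃ : Disjoint B₂ B₃) (h₁ : A₁.card = B₁.card)
    (h₂ : A₂.card = B₂.card) (h₃ : A₃.card = B₃.card) :
    ∃ σ : Equiv.Perm α, A₁.image σ = B₁ ∧ A₂.image σ = B₂ ∧ A₃.image σ = B₃ := by
  -- The three sets and the complement of their union become four colour classes; a permutation that
  -- matches colours moves all three sets at once.
  set col : Finset α → Finset α → Finset α → α → Fin 4 := fun S₁ S₂ S₃ a =>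
    if a ∈ S₁ then 0 else if a ∈ S₂ then 1 else if a ∈ S₃ then 2 else 3 with hcol
  have col0 : ∀ S₁ S₂ S₃ a, col S₁ S₂ S₃ a = 0 ↔ a ∈ S₁ := by
    intro S₁ S₂ S₃ a
    simp only [hcol]
    split_ifs <;> simp_all
  have col1 : ∀ S₁ S₂ S₃, Disjoint S₁ S₂ → ∀ a, col S₁ S₂ S₃ a = 1 ↔ a ∈ S₂ := by
    intro S₁ S₂ S₃ h a
    have := fun ha : a ∈ _ => Finset.disjoint_left.1 h ha
    simp only [hcol]
    split_ifs <;> simp_all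
  have col2 : ∀ S₁ S₂ S₃, Disjoint S₁ S₃ → Disjoint S₂ S₃ → ∀ a,
      col S₁ S₂ S₃ a = 2 ↔ a ∈ S₃ := by
    intro S₁ S₂ S₃ h h' a
    have := fun ha : a ∈ _ => Finset.disjoint_left.1 h ha
    have := fun ha : a ∈ _ => Finset.disjoint_left.1 h' ha
    simp only [hcol]
    split_ifs <;> simp_all
  have col3 : ∀ S₁ S₂ S₃ a, col S₁ S₂ S₃ a = 3 ↔ a ∉ S₁ ∪ S₂ ∪ S₃ := by
    intro S₁ S₂ S₃ a
    simp only [hcol, Finset.mem_union]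
    split_ifs <;> simp_all
  have hun : ∀ S₁ S₂ S₃ : Finset α, Disjoint S₁ S₂ → Disjoint S₁ S₃ → Disjoint S₂ S₃ →
      (S₁ ∪ S₂ ∪ S₃).card = S₁.card + S₂.card + S₃.card := fun S₁ S₂ S₃ h h' h'' => by
    rw [Finset.card_union_of_disjoint (Finset.disjoint_union_left.2 ⟨h', h''⟩),
      Finset.card_union_of_disjoint h]
  obtain ⟨σ, hσ⟩ := exists_perm_comp_eq (f := col A₁ A₂ A₃) (g := col B₁ B₂ B₃) (by
    intro c
    fin_cases c
    · change (Finset.univ.filter fun a => _ = (0 : Fin 4)).card =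
        (Finset.univ.filter fun a => _ = (0 : Fin 4)).card
      simpa [col0] using h₁
    · change (Finset.univ.filter fun a => _ = (1 : Fin 4)).card =
        (Finset.univ.filter fun a => _ = (1 : Fin 4)).card
      simpa [col1 _ _ _ hA₁₂, col1 _ _ _ hB₁₂] using h₂
    · change (Finset.univ.filter fun a => _ = (2 : Fin 4)).card =
        (Finset.univ.filter fun a => _ = (2 : Fin 4)).card
      simpa [col2 _ _ _ hA₁₃ hA₂₃, col2 _ _ _ hB₁₃ hB₂₃] using h₃
    · change (Finset.univ.filter fun a => _ = (3 : Fin 4)).card =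
        (Finset.univ.filter fun a => _ = (3 : Fin 4)).card
      simp_rw [col3]
      have hc : ∀ S : Finset α, (Finset.univ.filter fun a => a ∉ S) = Sᶜ := fun S => by
        ext a
        simp
      rw [hc, hc, Finset.card_compl, Finset.card_compl, hun _ _ _ hA₁₂ hA₁₃ hA₂₃,
        hun _ _ _ hB₁₂ hB₁₃ hB₂₃, h₁, h₂, h₃])
  have himg : ∀ A B : Finset α, (∀ a, σ a ∈ B ↔ a ∈ A) → A.image σ = B := by
    intro A B h
    ext b
    rw [Finset.mem_image]
    constructor
    · rintro ⟨a, ha, rfl⟩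
      exact (h a).2 ha
    · intro hb
      exact ⟨σ.symm b, (h _).1 (by rwa [Equiv.apply_symm_apply]), Equiv.apply_symm_apply _ _⟩
  refine ⟨σ, himg _ _ fun a => ?_, himg _ _ fun a => ?_, himg _ _ fun a => ?_⟩
  · rw [← col0 B₁ B₂ B₃, hσ, col0]
  · rw [← col1 B₁ B₂ B₃ hB₁₂, hσ, col1 _ _ _ hA₁₂]
  · rw [← col2 B₁ B₂ B₃ hB₁₃ hB₂₃, hσ, col2 _ _ _ hA₁₃ hA₂₃]

end Permutations

/-! ### The birthday bound -/

section Collisions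

/-- With `(M)ₖ` the falling factorial, `Mᵏ⁺¹ - (M)ₖ₊₁ = M (Mᵏ - (M)ₖ) + k (M)ₖ` and `(M)ₖ ≤ Mᵏ`: the
new user adds `k` possible collisions. -/
lemma pow_sub_descFactorial_mul_le (M k : ℕ) (hk : k ≤ M) :
    ((M : ℝ) ^ k - M.descFactorial k) * M ≤ (k.choose 2 : ℝ) * M ^ k := by
  induction k with
  | zero => simp
  | succ k ih =>
    have ih := ih (by omega)
    have hd : (M.descFactorial k : ℝ) ≤ M ^ k := by exact_mod_cast Nat.descFactorial_le_pow M k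
    rw [Nat.descFactorial_succ, Nat.choose_succ_succ' k 1, Nat.choose_one_right]
    push_cast [Nat.cast_sub (show k ≤ M by omega)]
    have h1 := mul_le_mul_of_nonneg_left hd (Nat.cast_nonneg (α := ℝ) k)
    have h2 := mul_le_mul_of_nonneg_right ih (Nat.cast_nonneg (α := ℝ) M)
    have h3 := mul_le_mul_of_nonneg_right h1 (Nat.cast_nonneg (α := ℝ) M)
    rw [pow_succ]
    nlinarith

/-- The birthday bound on the probability that two users send the same message. -/
lemma card_not_injective_mul_le {M Ka : ℕ} (hM : 0 < M) (hKa : Ka ≤ M) :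
    ((Finset.univ.filter fun w : Fin Ka → Fin M => ¬ Function.Injective w).card : ℝ≥0∞) *
      ((M : ℝ≥0∞)⁻¹) ^ Ka ≤ ENNReal.ofReal ((Ka.choose 2 : ℝ) / M) := by
  classical
  have hinj : (Finset.univ.filter fun w : Fin Ka → Fin M => Function.Injective w).card =
      M.descFactorial Ka := by
    rw [← Fintype.card_subtype, Fintype.card_congr (Equiv.subtypeInjectiveEquivEmbedding _ _),
      Fintype.card_embedding_eq, Fintype.card_fin, Fintype.card_fin]
  have hsum := Finset.card_filter_add_card_filter_not (s := Finset.univ)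
    fun w : Fin Ka → Fin M => Function.Injective w
  rw [hinj, Finset.card_univ, Fintype.card_fun, Fintype.card_fin, Fintype.card_fin] at hsum
  set c := (Finset.univ.filter fun w : Fin Ka → Fin M => ¬ Function.Injective w).card
  have hc : (c : ℝ) = (M : ℝ) ^ Ka - M.descFactorial Ka := by
    rw [eq_sub_iff_add_eq, add_comm]
    exact_mod_cast hsum
  have hM0 : (0 : ℝ) < M := by exact_mod_cast hM
  have key : (c : ℝ) * ((M : ℝ)⁻¹) ^ Ka ≤ (Ka.choose 2 : ℝ) / M := by
    rw [le_div_iff₀ hM0, inv_pow, mul_right_comm, ← div_eq_mul_inv, div_le_iff₀ (by positivity), hc]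
    exact pow_sub_descFactorial_mul_le M Ka hKa
  refine le_of_eq_of_le ?_ (ENNReal.ofReal_le_ofReal key)
  rw [ENNReal.ofReal_mul (Nat.cast_nonneg _), ENNReal.ofReal_pow (by positivity),
    ENNReal.ofReal_inv_of_pos hM0, ENNReal.ofReal_natCast, ENNReal.ofReal_natCast]

end Collisions

/-! ### The random coding bound -/

section RandomCoding

open scoped ComplexOrder

variable {n M L Ka t : ℕ}

lemma covMat_comp_perm (C : Fin M → EuclideanSpace ℂ (Fin n)) (σ : Equiv.Perm (Fin M))
    (S : Finset (Fin M)) : covMat (C ∘ σ) S = covMat C (S.image σ) := by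
  rw [covMat, covMat]
  congr 1
  ext i j
  rw [subcode_mul_conjTranspose_apply, subcode_mul_conjTranspose_apply,
    Finset.sum_image fun a _ b _ h => σ.injective h]
  rfl

lemma covMat_sdiff_add (C : Fin M → EuclideanSpace ℂ (Fin n)) {S T : Finset (Fin M)} (h : T ⊆ S) :
    covMat C (S \ T) + subcode C T * (subcode C T)ᴴ = covMat C S := by
  rw [covMat, covMat, add_assoc]
  congr 1
  ext i j
  rw [Matrix.add_apply, subcode_mul_conjTranspose_apply, subcode_mul_conjTranspose_apply,
    subcode_mul_conjTranspose_apply, Finset.sum_sdiff h]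

lemma measurable_gaussLaw_covMat (S : Finset (Fin M))
    {Q : (Fin M → EuclideanSpace ℂ (Fin n)) → (Fin n → Fin L → ℂ) → Prop}
    (hQ : MeasurableSet {p : (Fin M → EuclideanSpace ℂ (Fin n)) × (Fin n → Fin L → ℂ) |
      Q p.1 p.2}) :
    Measurable fun C => gaussLaw (Fin L) (covMat C S) {y | Q C y} := by
  have h : ∀ C : Fin M → EuclideanSpace ℂ (Fin n),
      gaussLaw (Fin L) (covMat C S) {y | Q C y} =
      ∫⁻ y, ENNReal.ofReal (gaussDensity (covMat C S) y) *
        {p : (Fin M → EuclideanSpace ℂ (Fin n)) × (Fin n → Fin L → ℂ) |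
          Q p.1 p.2}.indicator 1 (C, y) := by
    intro C
    exact gaussLaw_apply _ (measurable_prodMk_left hQ)
  simp_rw [h]
  refine Measurable.lintegral_prod_right' (f := fun p : (Fin M → EuclideanSpace ℂ (Fin n)) ×
    (Fin n → Fin L → ℂ) => ENNReal.ofReal (gaussDensity (covMat p.1 S) p.2) *
      {p : (Fin M → EuclideanSpace ℂ (Fin n)) × (Fin n → Fin L → ℂ) |
        Q p.1 p.2}.indicator 1 p) ?_
  exact (continuous_gaussDensity_comp ((continuous_covMat S).comp continuous_fst)
    (fun _ => posDef_covMat _ _) continuous_snd).measurable.ennreal_ofReal.mul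
    (measurable_one.indicator hQ)

lemma measurable_metric_covMat (S : Finset (Fin M)) :
    Measurable fun p : (Fin M → EuclideanSpace ℂ (Fin n)) × (Fin n → Fin L → ℂ) =>
      metric (covMat p.1 S) p.2 :=
  (continuous_metric_comp ((continuous_covMat S).comp continuous_fst)
    (fun _ => posDef_covMat _ _) continuous_snd).measurable

/-- The probability that the codewords in `S'` have a smaller metric than the transmitted ones
(those in `S`), inside the region where the metric of the latter is not too large. -/
noncomputable def pairwiseProb (L : ℕ) (ω ν : ℝ) (S S₁ S' : Finset (Fin M))
    (C : Fin M → EuclideanSpace ℂ (Fin n)) : ℝ≥0∞ :=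
  gaussLaw (Fin L) (covMat C S) {y | metric (covMat C S') y ≤ metric (covMat C S) y ∧
    metric (covMat C S) y ≤ ω * metric (covMat C S₁) y + n * L * ν}

/-- The probability that the metric of the transmitted codewords is too large. -/
noncomputable def outsideProb (L : ℕ) (ω ν : ℝ) (S S₁ : Finset (Fin M))
    (C : Fin M → EuclideanSpace ℂ (Fin n)) : ℝ≥0∞ :=
  gaussLaw (Fin L) (covMat C S)
    {y | ω * metric (covMat C S₁) y + n * L * ν < metric (covMat C S) y}

/-- The probability that some set with exactly `t` missed messages has at most the metric of the
transmitted set `S`. -/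
noncomputable def missProb (L t : ℕ) (S : Finset (Fin M))
    (C : Fin M → EuclideanSpace ℂ (Fin n)) : ℝ≥0∞ :=
  gaussLaw (Fin L) (covMat C S) {y | ∃ W₁ ∈ S.powersetCard t, ∃ W₂ ∈ Sᶜ.powersetCard t,
    metric (covMat C (S \ W₁ ∪ W₂)) y ≤ metric (covMat C S) y}

lemma measurable_pairwiseProb (ω ν : ℝ) (S S₁ S' : Finset (Fin M)) :
    Measurable (pairwiseProb (n := n) L ω ν S S₁ S') :=
  measurable_gaussLaw_covMat S (Q := fun C y => metric (covMat C S') y ≤ metric (covMat C S) y ∧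
    metric (covMat C S) y ≤ ω * metric (covMat C S₁) y + n * L * ν)
    ((measurableSet_le (measurable_metric_covMat S') (measurable_metric_covMat S)).inter
      (measurableSet_le (measurable_metric_covMat S)
        (((measurable_metric_covMat S₁).const_mul ω).add_const (n * L * ν))))

lemma measurable_outsideProb (ω ν : ℝ) (S S₁ : Finset (Fin M)) :
    Measurable (outsideProb (n := n) L ω ν S S₁) :=
  measurable_gaussLaw_covMat S (Q := fun C y => ω * metric (covMat C S₁) y + n * L * ν <
    metric (covMat C S) y) (measurableSet_lt
    (((measurable_metric_covMat S₁).const_mul ω).add_const (n * L * ν))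
    (measurable_metric_covMat S))

lemma measurable_missProb (S : Finset (Fin M)) : Measurable (missProb (n := n) L t S) := by
  have : MeasurableSet {p : (Fin M → EuclideanSpace ℂ (Fin n)) × (Fin n → Fin L → ℂ) |
      ∃ W₁ ∈ S.powersetCard t, ∃ W₂ ∈ Sᶜ.powersetCard t,
        metric (covMat p.1 (S \ W₁ ∪ W₂)) p.2 ≤ metric (covMat p.1 S) p.2} := by
    have heq : {p : (Fin M → EuclideanSpace ℂ (Fin n)) × (Fin n → Fin L → ℂ) |
        ∃ W₁ ∈ S.powersetCard t, ∃ W₂ ∈ Sᶜ.powersetCard t,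
          metric (covMat p.1 (S \ W₁ ∪ W₂)) p.2 ≤ metric (covMat p.1 S) p.2} =
        ⋃ W₁ ∈ S.powersetCard t, ⋃ W₂ ∈ Sᶜ.powersetCard t,
          {p | metric (covMat p.1 (S \ W₁ ∪ W₂)) p.2 ≤ metric (covMat p.1 S) p.2} := by
      ext p
      simp only [Set.mem_ofPred_eq, Set.mem_iUnion, exists_prop]
    rw [heq]
    exact Finset.measurableSet_biUnion _ fun W₁ _ => Finset.measurableSet_biUnion _ fun W₂ _ =>
      measurableSet_le (measurable_metric_covMat _) (measurable_metric_covMat S)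
  exact measurable_gaussLaw_covMat S (Q := fun C y => ∃ W₁ ∈ S.powersetCard t,
    ∃ W₂ ∈ Sᶜ.powersetCard t, metric (covMat C (S \ W₁ ∪ W₂)) y ≤ metric (covMat C S) y) this

/-- The union bound is taken after splitting by the good region. The region depends on `W₁` only, so
its complement is paid for once per `W₁` and not once per pair. -/
lemma missProb_le (ω ν : ℝ) (S : Finset (Fin M)) (C : Fin M → EuclideanSpace ℂ (Fin n)) :
    missProb L t S C ≤ ∑ W₁ ∈ S.powersetCard t, ∑ W₂ ∈ Sᶜ.powersetCard t,
      pairwiseProb L ω ν S (S \ W₁) (S \ W₁ ∪ W₂) C +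
      ∑ W₁ ∈ S.powersetCard t, outsideProb L ω ν S (S \ W₁) C := by
  have hsub : {y : Fin n → Fin L → ℂ | ∃ W₁ ∈ S.powersetCard t, ∃ W₂ ∈ Sᶜ.powersetCard t,
      metric (covMat C (S \ W₁ ∪ W₂)) y ≤ metric (covMat C S) y} ⊆
      (⋃ W₁ ∈ S.powersetCard t, ⋃ W₂ ∈ Sᶜ.powersetCard t,
        {y | metric (covMat C (S \ W₁ ∪ W₂)) y ≤ metric (covMat C S) y ∧
          metric (covMat C S) y ≤ ω * metric (covMat C (S \ W₁)) y + n * L * ν}) ∪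
      ⋃ W₁ ∈ S.powersetCard t,
        {y | ω * metric (covMat C (S \ W₁)) y + n * L * ν < metric (covMat C S) y} := by
    intro y hy
    obtain ⟨W₁, h₁, W₂, h₂, hle⟩ := hy
    simp only [Set.mem_union, Set.mem_iUnion, Set.mem_ofPred_eq, exists_prop]
    by_cases h : metric (covMat C S) y ≤ ω * metric (covMat C (S \ W₁)) y + n * L * ν
    · exact Or.inl ⟨W₁, h₁, W₂, h₂, hle, h⟩
    · exact Or.inr ⟨W₁, h₁, not_le.1 h⟩
  refine (measure_mono hsub).trans ((measure_union_le _ _).trans (add_le_add ?_ ?_))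
  · refine (measure_biUnion_finset_le _ _).trans (Finset.sum_le_sum fun W₁ _ => ?_)
    exact measure_biUnion_finset_le _ _
  · exact measure_biUnion_finset_le _ _

lemma card_sent (hKa : Ka ≤ M) : (sent M Ka).card = Ka := by
  rw [sent, Fin.card_filter_val_lt, min_eq_right hKa]

lemma card_missed (ht : t ≤ M) : (missed M t).card = t := card_sent ht

lemma missed_subset_sent (ht : t ≤ Ka) : missed M t ⊆ sent M Ka := fun i hi => by
  simp only [missed, sent, Finset.mem_filter_univ] at hi ⊢
  omega

lemma disjoint_sent_falseAlarm : Disjoint (sent M Ka) (falseAlarm M Ka t) :=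
  Finset.disjoint_left.2 fun i hi hi' => by
    simp only [sent, falseAlarm, Finset.mem_filter_univ] at hi hi'
    omega

lemma card_falseAlarm (h : Ka + t ≤ M) : (falseAlarm M Ka t).card = t := by
  have hun : sent M Ka ∪ falseAlarm M Ka t = sent M (Ka + t) := by
    ext i
    simp only [sent, falseAlarm, Finset.mem_union, Finset.mem_filter_univ]
    omega
  have := Finset.card_union_of_disjoint (disjoint_sent_falseAlarm (M := M) (Ka := Ka) (t := t))
  rw [hun, card_sent h, card_sent (by omega)] at this
  omega

/-- A permutation of the messages carries the fixed index sets to `S`, `W₁`, `W₂` and preserves the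
codebook law. It is applied to the measurable `pairwiseProb`, before the pointwise Chernoff bound;
the infimum over `u` and `r` then enters only through monotonicity, so its measurability is never
needed. -/
lemma lintegral_pairwiseProb_le (hn : 1 ≤ n) (hKa : Ka ≤ M) (e : Ensemble) (P' : ℝ) (ht : t ≤ Ka)
    {S W₁ W₂ : Finset (Fin M)} (hS : S.card = Ka) (hW₁ : W₁ ∈ S.powersetCard t)
    (hW₂ : W₂ ∈ Sᶜ.powersetCard t) (ω ν : ℝ) :
    ∫⁻ C, pairwiseProb L ω ν S (S \ W₁) (S \ W₁ ∪ W₂) C ∂codebookLaw n M P' e ≤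
      ∫⁻ C, (⨅ u : ℝ, ⨅ r : ℝ, ⨅ _ : 0 ≤ u ∧ 0 ≤ r ∧ EigenvaluesPos (matB Ka t ω u r C),
        ENNReal.ofReal (Real.exp (L * r * n * ν) *
          Real.exp (L * ((u - r) * logDet (matF Ka C) - u * logDet (matF' Ka t C)
            + r * ω * logDet (matF₁ Ka t C) - logDet (matB Ka t ω u r C)))))
        ∂codebookLaw n M P' e := by
  obtain ⟨hW₁S, hW₁c⟩ := Finset.mem_powersetCard.1 hW₁
  obtain ⟨hW₂S, hW₂c⟩ := Finset.mem_powersetCard.1 hW₂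
  have hSW₂ : Disjoint S W₂ := Finset.disjoint_left.2 fun i hi hi' =>
    Finset.mem_compl.1 (hW₂S hi') hi
  -- That some `W₂` exists outside `S` guarantees that `falseAlarm` is not cut off at `M` and has
  -- exactly `t` elements.
  have hKt : Ka + t ≤ M := by
    have := (Finset.card_union_of_disjoint hSW₂).symm.trans_le (Finset.card_le_univ _)
    rwa [hS, hW₂c, Fintype.card_fin] at this
  have hms := missed_subset_sent (M := M) ht
  obtain ⟨σ, h1, h2, h3⟩ := exists_perm_image_eq (A₁ := missed M t) (A₂ := sent M Ka \ missed M t)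
    (A₃ := falseAlarm M Ka t) (B₁ := W₁) (B₂ := S \ W₁) (B₃ := W₂) Finset.disjoint_sdiff
    (disjoint_sent_falseAlarm.mono_left hms)
    (disjoint_sent_falseAlarm.mono_left Finset.sdiff_subset) Finset.disjoint_sdiff
    (hSW₂.mono_left hW₁S) (hSW₂.mono_left Finset.sdiff_subset)
    (by rw [card_missed (by omega), hW₁c])
    (by rw [Finset.card_sdiff_of_subset hms, Finset.card_sdiff_of_subset hW₁S, card_sent hKa,
      card_missed (by omega), hS, hW₁c])
    (by rw [card_falseAlarm hKt, hW₂c])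
  have hsent : (sent M Ka).image σ = S := by
    rw [← Finset.union_sdiff_of_subset hms, Finset.image_union, h1, h2,
      Finset.union_sdiff_of_subset hW₁S]
  have hcomp : ∀ C : Fin M → EuclideanSpace ℂ (Fin n),
      pairwiseProb L ω ν S (S \ W₁) (S \ W₁ ∪ W₂) C = pairwiseProb L ω ν (sent M Ka)
        (sent M Ka \ missed M t) (sent M Ka \ missed M t ∪ falseAlarm M Ka t) (C ∘ σ) := by
    intro C
    simp only [pairwiseProb, covMat_comp_perm, Finset.image_union, hsent, h2, h3]
  simp_rw [hcomp]
  rw [(measurePreserving_comp_perm hn P' e σ).lintegral_comp (measurable_pairwiseProb ω ν _ _ _)]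
  refine lintegral_mono fun C => le_iInf fun u => le_iInf fun r => le_iInf fun h => ?_
  exact gaussLaw_metric_le (posDef_covMat _ _) (posDef_covMat _ _) (posDef_covMat _ _) h.1 h.2.1
    rfl h.2.2

lemma lintegral_outsideProb_le (hn : 1 ≤ n) (hL : 1 ≤ L) (hKa : Ka ≤ M) (e : Ensemble) (P' : ℝ)
    (ht1 : 1 ≤ t) (ht : t ≤ Ka) {S W₁ : Finset (Fin M)} (hS : S.card = Ka)
    (hW₁ : W₁ ∈ S.powersetCard t) {ω ν δ : ℝ} (hω : 0 ≤ ω) (hω1 : ω ≤ 1) (hδ : 0 ≤ δ) :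
    ∫⁻ C, outsideProb L ω ν S (S \ W₁) C ∂codebookLaw n M P' e ≤
      ENNReal.ofReal (upperGamma (n * L) (n * L * (1 + δ)) / Real.Gamma (n * L))
      + ∫⁻ C, ENNReal.ofReal (lowerGammaRatio (L * (min n t : ℕ)) (cNum L Ka t ω ν δ C)
          (ω * eigGeomMean Ka t (min n t) C)) ∂(codebookLaw n M P' e) := by
  obtain ⟨hW₁S, hW₁c⟩ := Finset.mem_powersetCard.1 hW₁
  have := isProbabilityMeasure_codebookLaw (M := M) hn P' e
  have hms := missed_subset_sent (M := M) ht
  obtain ⟨σ, h1, h2, -⟩ := exists_perm_image_eq (A₁ := missed M t) (A₂ := sent M Ka \ missed M t)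
    (A₃ := ∅) (B₁ := W₁) (B₂ := S \ W₁) (B₃ := ∅) Finset.disjoint_sdiff
    (Finset.disjoint_empty_right _) (Finset.disjoint_empty_right _) Finset.disjoint_sdiff
    (Finset.disjoint_empty_right _) (Finset.disjoint_empty_right _)
    (by rw [card_missed (by omega), hW₁c])
    (by rw [Finset.card_sdiff_of_subset hms, Finset.card_sdiff_of_subset hW₁S, card_sent hKa,
      card_missed (by omega), hS, hW₁c]) rfl
  have hsent : (sent M Ka).image σ = S := by
    rw [← Finset.union_sdiff_of_subset hms, Finset.image_union, h1, h2,
      Finset.union_sdiff_of_subset hW₁S]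
  have hcomp : ∀ C : Fin M → EuclideanSpace ℂ (Fin n),
      outsideProb L ω ν S (S \ W₁) C =
        outsideProb L ω ν (sent M Ka) (sent M Ka \ missed M t) (C ∘ σ) := by
    intro C
    simp only [outsideProb, covMat_comp_perm, hsent, h2]
  simp_rw [hcomp]
  rw [(measurePreserving_comp_perm hn P' e σ).lintegral_comp (measurable_outsideProb ω ν _ _)]
  have hconst : ∀ c : ℝ≥0∞, c = ∫⁻ _, c ∂codebookLaw n M P' e := fun c => by
    rw [lintegral_const, measure_univ, mul_one]
  rw [hconst (ENNReal.ofReal (_ / _)), ← lintegral_add_left measurable_const]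
  refine lintegral_mono fun C => ?_
  -- The matrix `C_{𝒲₁} C_{𝒲₁}ᴴ` has rank at most `min n t`, so keeping this many of the largest
  -- eigenvalues discards only zeros.
  have h := gaussLaw_metric_gt_le hL (m := min n t) (by omega) (min_le_left _ _)
    (posDef_covMat C (sent M Ka \ missed M t))
    (Matrix.posSemidef_self_mul_conjTranspose (subcode C (missed M t))) (ν := ν) hω hω1 hδ
  rw [covMat_sdiff_add C hms] at h
  exact h

lemma lintegral_missProb_le (hn : 1 ≤ n) (hL : 1 ≤ L) (hKa : Ka ≤ M) (e : Ensemble) (P' : ℝ)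
    (ht1 : 1 ≤ t) (ht : t ≤ Ka) {S : Finset (Fin M)} (hS : S.card = Ka) :
    ∫⁻ C, missProb L t S C ∂codebookLaw n M P' e ≤ p n M L Ka e P' t := by
  refine le_iInf fun ω => le_iInf fun ν => le_iInf fun h => ?_
  refine (lintegral_mono fun C => missProb_le ω ν S C).trans ?_
  rw [lintegral_add_left (Finset.measurable_sum _ fun W₁ _ => Finset.measurable_sum _ fun W₂ _ =>
      measurable_pairwiseProb ω ν _ _ _),
    lintegral_finsetSum _ fun W₁ _ => Finset.measurable_sum _ fun W₂ _ =>
      measurable_pairwiseProb ω ν _ _ _,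
    lintegral_finsetSum _ fun W₁ _ => measurable_outsideProb ω ν _ _]
  refine add_le_add ?_ ?_
  · rw [q₁, mul_assoc, ← nsmul_eq_mul, ← nsmul_eq_mul]
    have h1 : Ka.choose t = (S.powersetCard t).card := by rw [Finset.card_powersetCard, hS]
    have h2 : (M - Ka).choose t = (Sᶜ.powersetCard t).card := by
      rw [Finset.card_powersetCard, Finset.card_compl, hS, Fintype.card_fin]
    rw [h1, h2]
    refine Finset.sum_le_card_nsmul _ _ _ fun W₁ hW₁ => ?_
    rw [lintegral_finsetSum _ fun W₂ _ => measurable_pairwiseProb ω ν _ _ _]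
    exact Finset.sum_le_card_nsmul _ _ _ fun W₂ hW₂ =>
      lintegral_pairwiseProb_le hn hKa e P' ht hS hW₁ hW₂ ω ν
  · rw [q₂, ← nsmul_eq_mul]
    have h1 : Ka.choose t = (S.powersetCard t).card := by rw [Finset.card_powersetCard, hS]
    rw [h1]
    exact Finset.sum_le_card_nsmul _ _ _ fun W₁ hW₁ => le_iInf fun δ => le_iInf fun hδ =>
      lintegral_outsideProb_le hn hL hKa e P' ht1 ht hS hW₁ h.1 h.2.1 hδ

/-- The maximum likelihood decoder. -/
lemma exists_maximum_likelihood_decoder (hKa : Ka ≤ M) (C : Fin M → EuclideanSpace ℂ (Fin n)) :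
    ∃ dec : (Fin n → Fin L → ℂ) → Finset (Fin M), (∀ S, MeasurableSet (dec ⁻¹' {S})) ∧
      (∀ y, (dec y).card = Ka) ∧ ∀ S : Finset (Fin M), S.card = Ka →
        gaussLaw (Fin L) (covMat C S) {y | S ≠ dec y} ≤
          ∑ t ∈ Finset.Icc 1 Ka, missProb L t S C := by
  obtain ⟨dec, h1, h2, h3, -⟩ := exists_measurable_argmin
    (f := fun S (y : Fin n → Fin L → ℂ) => metric (covMat C S) y) (decodable_nonempty hKa)
    fun S _ => (continuous_metric (covMat C S)).measurable
  have hcard : ∀ y, (dec y).card = Ka := fun y => Finset.mem_powersetCard_univ.1 (h1 y)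
  refine ⟨dec, h2, hcard, fun S hS => ?_⟩
  refine (measure_mono fun y hy => ?_).trans (measure_biUnion_finset_le _ _)
  -- The sent and the decoded set both have `Ka` elements, so there are as many false alarms as
  -- misses; their common number is the `t` of the union bound.
  have hcd : (S \ dec y).card = (dec y \ S).card :=
    Finset.card_sdiff_comm (by rw [hS, hcard])
  have hpos : 1 ≤ (S \ dec y).card := by
    rw [Nat.one_le_iff_ne_zero, Ne, Finset.card_eq_zero, Finset.sdiff_eq_empty_iff_subset]
    exact fun hsub => hy (Finset.eq_of_subset_of_card_le hsub (by rw [hS, hcard]))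
  simp only [Set.mem_iUnion, exists_prop, Set.mem_ofPred_eq]
  refine ⟨(S \ dec y).card, Finset.mem_Icc.2 ⟨hpos, hS ▸ Finset.card_le_card Finset.sdiff_subset⟩,
    S \ dec y, Finset.mem_powersetCard.2 ⟨Finset.sdiff_subset, rfl⟩, dec y \ S,
    Finset.mem_powersetCard.2 ⟨fun i hi => Finset.mem_compl.2 (Finset.mem_sdiff.1 hi).2, hcd.symm⟩,
    ?_⟩
  have hun : S \ (S \ dec y) ∪ dec y \ S = dec y := by
    ext i
    simp only [Finset.mem_union, Finset.mem_sdiff]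
    tauto
  rw [hun]
  exact h3 y S (Finset.mem_powersetCard_univ.2 hS)

/-- The codebook in which the codewords that violate the power constraint are replaced by `0`. -/
noncomputable def truncate (P : ℝ) (C : Fin M → EuclideanSpace ℂ (Fin n)) :
    Fin M → EuclideanSpace ℂ (Fin n) :=
  fun m => if ‖C m‖ ^ 2 ≤ n * P then C m else 0

lemma norm_truncate_sq_le {P : ℝ} (hP : 0 ≤ P) (C : Fin M → EuclideanSpace ℂ (Fin n)) (m : Fin M) :
    ‖truncate P C m‖ ^ 2 ≤ n * P := by
  rw [truncate]
  split_ifs with h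
  · exact h
  · rw [norm_zero, zero_pow two_ne_zero]
    positivity

-- Since `bayesError` is minimal over decoders, the truncated codebook may be used with the maximum
-- likelihood decoder of the original one. The two codebooks give the same law whenever all sent
-- codewords obey the power constraint; when one does not, or when messages repeat, the error
-- probability is bounded by `1`.
open Classical in
lemma bayesError_truncate_le (hM : 0 < M) (hKa : Ka ≤ M) (P : ℝ)
    (C : Fin M → EuclideanSpace ℂ (Fin n)) :
    bayesError L Ka (truncate P C) ≤ ∑ w : Fin Ka → Fin M, ((M : ℝ≥0∞)⁻¹) ^ Ka *
      (if Function.Injective w then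
        ∑ k, {c : EuclideanSpace ℂ (Fin n) | n * P < ‖c‖ ^ 2}.indicator 1 (C (w k)) +
          ∑ t ∈ Finset.Icc 1 Ka, missProb L t (Finset.univ.image w) C
      else 1) := by
  obtain ⟨dec, h1, h2, h3⟩ := exists_maximum_likelihood_decoder (L := L) hKa C
  refine (bayesError_le hM _ h1 h2).trans ?_
  rw [jointErrorProb_eq_sum hM _ h1]
  refine Finset.sum_le_sum fun w _ => mul_le_mul_right ?_ _
  split_ifs with hw
  · by_cases hv : ∀ k, ‖C (w k)‖ ^ 2 ≤ n * P
    · have : sentCov (truncate P C) w = covMat C (Finset.univ.image w) := by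
        rw [← sentCov_eq_covMat C hw, sentCov, sentCov]
        have : sentMat (truncate P C) w = sentMat C w := by
          ext i k
          simp [sentMat, truncate, hv k]
        rw [this]
      rw [this]
      refine (h3 _ ?_).trans le_add_self
      rw [Finset.card_image_of_injective _ hw, Finset.card_univ, Fintype.card_fin]
    · push Not at hv
      obtain ⟨k, hk⟩ := hv
      refine prob_le_one.trans (le_add_right ?_)
      refine le_of_eq_of_le ?_ (Finset.single_le_sum (fun _ _ => zero_le) (Finset.mem_univ k))
      rw [Set.indicator_of_mem (by exact hk), Pi.one_apply]
  · exact prob_le_one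

/-- The random coding bound. -/
lemma exists_codebook (hn : 1 ≤ n) (hL : 1 ≤ L) (hM : 0 < M) (hKa : Ka ≤ M) {e : Ensemble}
    {P P' : ℝ} (hP : 0 ≤ P) (hP' : P' ∈ powerRange P e) :
    ∃ x : Fin M → EuclideanSpace ℂ (Fin n), (∀ m, ‖x m‖ ^ 2 ≤ n * P) ∧
      bayesError L Ka x ≤ p₀ n M Ka e P P' + ∑ t ∈ Finset.Icc 1 Ka, p n M L Ka e P' t := by
  classical
  have := isProbabilityMeasure_codewordLaw hn P' e
  have := isProbabilityMeasure_codebookLaw (M := M) hn P' e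
  set V : Set (EuclideanSpace ℂ (Fin n)) := {c | n * P < ‖c‖ ^ 2} with hV
  have hVm : MeasurableSet V := measurableSet_lt measurable_const (by fun_prop)
  set G : (Fin Ka → Fin M) → (Fin M → EuclideanSpace ℂ (Fin n)) → ℝ≥0∞ := fun w C =>
    if Function.Injective w then ∑ k, V.indicator 1 (C (w k)) +
      ∑ t ∈ Finset.Icc 1 Ka, missProb L t (Finset.univ.image w) C else 1 with hG
  have hind : ∀ m, Measurable fun C : Fin M → EuclideanSpace ℂ (Fin n) =>
      V.indicator (1 : EuclideanSpace ℂ (Fin n) → ℝ≥0∞) (C m) := fun m =>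
    (measurable_one.indicator hVm).comp (measurable_pi_apply m)
  have hGm : ∀ w, Measurable (G w) := by
    intro w
    by_cases hw : Function.Injective w
    · simp only [hG, if_pos hw]
      exact (Finset.measurable_sum _ fun k _ => hind (w k)).add
        (Finset.measurable_sum _ fun t _ => measurable_missProb _)
    · simp only [hG, if_neg hw]
      exact measurable_const
  set q := ENNReal.ofReal (powerViolation n Ka P P' e) +
    ∑ t ∈ Finset.Icc 1 Ka, p n M L Ka e P' t with hq
  have hGi : ∀ w, ∫⁻ C, G w C ∂codebookLaw n M P' e ≤
      q + if ¬ Function.Injective w then 1 else 0 := by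
    intro w
    by_cases hw : Function.Injective w
    · rw [if_neg (not_not.2 hw), add_zero]
      simp only [hG, if_pos hw]
      rw [lintegral_add_left (Finset.measurable_sum _ fun k _ => hind (w k)),
        lintegral_finsetSum _ fun k _ => hind (w k),
        lintegral_finsetSum _ fun t _ => measurable_missProb _]
      refine add_le_add ?_ (Finset.sum_le_sum fun t ht => ?_)
      · have hk : ∀ k, ∫⁻ C, V.indicator 1 (C (w k)) ∂codebookLaw n M P' e =
            codewordLaw n P' e V := by
          intro k
          rw [codebookLaw, (measurePreserving_eval (fun _ : Fin M => codewordLaw n P' e)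
            (w k)).lintegral_comp (measurable_one.indicator hVm), lintegral_indicator_one hVm]
        simp_rw [hk]
        rw [Finset.sum_const, Finset.card_univ, Fintype.card_fin, nsmul_eq_mul,
          mul_codewordLaw_power_violation hn Ka hP']
      · obtain ⟨ht1, ht2⟩ := Finset.mem_Icc.1 ht
        refine lintegral_missProb_le hn hL hKa e P' ht1 ht2 ?_
        rw [Finset.card_image_of_injective _ hw, Finset.card_univ, Fintype.card_fin]
    · simp only [hG, if_neg hw]
      rw [lintegral_one, measure_univ, if_pos hw]
      exact le_add_self
  -- The bound is averaged over the random codebook, and some codebook does at least as well as the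
  -- average.
  obtain ⟨C, hC⟩ := exists_le_lintegral (μ := codebookLaw n M P' e)
    (f := fun C => ∑ w, ((M : ℝ≥0∞)⁻¹) ^ Ka * G w C)
    (Finset.measurable_sum _ fun w _ => (hGm w).const_mul _).aemeasurable
  refine ⟨truncate P C, norm_truncate_sq_le hP C, ?_⟩
  refine ((bayesError_truncate_le hM hKa P C).trans hC).trans ?_
  rw [lintegral_finsetSum _ fun w _ => (hGm w).const_mul _]
  have hviol : 0 ≤ powerViolation n Ka P P' e := by
    cases e
    · exact div_nonneg (mul_nonneg (Nat.cast_nonneg _) (setIntegral_nonneg measurableSet_Ioi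
        fun s hs => mul_nonneg (Real.rpow_nonneg ((by
          obtain ⟨h0, hlt⟩ : 0 < P' ∧ P' < P := hP'
          positivity : (0 : ℝ) ≤ n * P / P').trans (Set.mem_Ioi.1 hs).le) _)
          (Real.exp_pos _).le)) (Real.Gamma_nonneg_of_nonneg (Nat.cast_nonneg _))
    · exact le_rfl
  calc ∑ w : Fin Ka → Fin M, ∫⁻ C, ((M : ℝ≥0∞)⁻¹) ^ Ka * G w C ∂codebookLaw n M P' e
      ≤ ∑ w : Fin Ka → Fin M, ((M : ℝ≥0∞)⁻¹) ^ Ka *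
          (q + if ¬ Function.Injective w then 1 else 0) := by
        refine Finset.sum_le_sum fun w _ => ?_
        rw [lintegral_const_mul _ (hGm w)]
        exact mul_le_mul_right (hGi w) _
    -- There are `Mᴷᵃ` message vectors of weight `M⁻ᴷᵃ` each, so `q` gets total weight one and the
    -- rest is the probability of a repeated message.
    _ = ((M : ℝ≥0∞) * (M : ℝ≥0∞)⁻¹) ^ Ka * q +
          ((Finset.univ.filter fun w : Fin Ka → Fin M => ¬ Function.Injective w).card : ℝ≥0∞) *
            ((M : ℝ≥0∞)⁻¹) ^ Ka := by
        rw [← Finset.mul_sum, Finset.sum_add_distrib, Finset.sum_boole, Finset.sum_const,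
          Finset.card_univ, Fintype.card_fun, Fintype.card_fin, Fintype.card_fin, nsmul_eq_mul,
          mul_pow, Nat.cast_pow]
        ring
    _ ≤ q + ENNReal.ofReal ((Ka.choose 2 : ℝ) / M) := by
        rw [ENNReal.mul_inv_cancel (by positivity) (ENNReal.natCast_ne_top M), one_pow, one_mul]
        exact add_le_add le_rfl (card_not_injective_mul_le hM hKa)
    _ = p₀ n M Ka e P P' + ∑ t ∈ Finset.Icc 1 Ka, p n M L Ka e P' t := by
        rw [hq, p₀, ENNReal.ofReal_add (by positivity) hviol]
        ring

end RandomCoding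

end URA

theorem theorem10 (n M L Ka : ℕ) (hn : 1 ≤ n) (hL : 1 ≤ L) (hM : 2 ≤ M) (hKa : Ka ≤ M)
    (ε : ℝ≥0) (e : URA.Ensemble) :
    (∀ P : ℝ, 0 < P → URA.errorBound n M L Ka e P ≤ ε → Nonempty (URA.Code n M L Ka ε P)) ∧
    URA.minEnergyPerBit n M L Ka ε ≤
      ⨅ P ∈ {P : ℝ | 0 < P ∧ URA.errorBound n M L Ka e P ≤ ε},
        ENNReal.ofReal (URA.energyPerBit n M P) := by
  have h : ∀ P : ℝ, 0 < P → URA.errorBound n M L Ka e P ≤ ε →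
      Nonempty (URA.Code n M L Ka ε P) := by
    intro P hP hε
    refine URA.nonempty_code (by omega) hKa hP.le fun η hη => ?_
    -- The infimum over `P'` may not be attained, so a suitable `P'` exists only for targets `η`
    -- strictly above `ε`.
    obtain ⟨P', hP', hlt⟩ : ∃ P' ∈ URA.powerRange P e, URA.p₀ n M Ka e P P' +
        ∑ t ∈ Finset.Icc 1 Ka, URA.p n M L Ka e P' t < η := by
      simpa only [URA.errorBound, iInf_lt_iff, exists_prop] using hε.trans_lt hη
    obtain ⟨x, hx, hle⟩ := URA.exists_codebook hn hL (by omega : 0 < M) hKa hP.le hP'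
    exact ⟨x, hx, hle.trans hlt.le⟩
  exact ⟨h, biInf_mono fun P hP => ⟨hP.1, h P hP.1 hP.2⟩⟩
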